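/- Let $G$ be a finite group and fix a dimension $n\ge 0$. A $G$-manifold is a compact smooth (unoriented) $n$-manifold, possibly with boundary, with a smooth $G$-action. For a $G$-space $X$, let $\mathcal M^G(X)$ be the commutative monoid, under disjoint union, of equivalence classes of pairs $(M,f)$, where $M$ is a $G$-manifold and $f\colon M\to X$ is a continuous $G$-map; here $(M,f)\sim(M',f')$ if there is a $G$-diffeomorphism $\varphi\colon M\to M'$ with $f'\circ\varphi=f$. Two pairs $(M,f)$ and $(M',f')$ are related by an $SK$-operation in $X$ if $M=M_1\cup_\varphi M_2$ and $M'=M_1\cup_\psi M_2$, where $\varphi$ and $\psi$ are equivariant diffeomorphisms between the same parts (unions of components) of the boundaries of two $G$-manifolds $M_1$ and $M_2$, and $f|_{M_i}$ and $f'|_{M_i}$ are $G$-homotopic for $i=1,2$. They are $SK$-equivalent in $X$ if they are related by a finite sequence of $SK$-operations. Let $SK^G(X)$ be the quotient of the group completion of $\mathcal M^G(X)$ by $SK$-equivalence in $X$, and write $SK^G$ for $SK^G(\mathrm{pt})$. Let $\mathcal B_G$ be the Burnside category: its objects are the finite $G$-sets, and its morphisms from $X$ to $Y$ form the group completion of the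 commutative monoid (under disjoint union of the middle terms) of isomorphism classes of spans $X\leftarrow U\to Y$ of finite $G$-sets; composition is given by pullback of spans, extended biadditively. A $G$-Mackey functor is an additive functor from $\mathcal B_G$ to the category of abelian groups. Regard finite $G$-sets as discrete $G$-spaces. Then the following hold. 1. For every span $X\xleftarrow{\alpha}U\xrightarrow{\beta}Y$ of finite $G$-sets there is a homomorphism $(\alpha,\beta)\colon SK^G(X)\to SK^G(Y)$ with $$(\alpha,\beta)[M,f]=[\widetilde M,\beta\circ\widetilde f],$$ where $\widetilde M=\{(m,u)\in M\times U\mid f(m)=\alpha(u)\}$ is the pullback of $(M,f)$ along $\alpha$ and $\widetilde f\colon\widetilde M\to U$ is the projection. 2. There is a $G$-Mackey functor that sends a finite $G$-set $X$ to $SK^G(X)$ and the morphism represented by a span $X\xleftarrow{\alpha}U\xrightarrow{\beta}Y$ to $(\alpha,\beta)$. 3. For every subgroup $H\le G$ there is an isomorphism $SK^G(G/H)\cong SK^H$ that sends $[M,f]$ to the class of the $H$-manifold $f^{-1}(eH)$. Hence the groups $SK^H$, for $H\le G$, are the values at the orbits $G/H$ of a $G$-Mackey functor. -/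

import Mathlib

open CategoryTheory Topology
open scoped Manifold ContDiff

universe u

/-! ### The model space: the half space of dimension `n` (a point if `n = 0`) -/

/-- The model space for `n`-dimensional manifolds with boundary. -/
def BoundaryModelSpace : ℕ → Type
  | 0 => EuclideanSpace ℝ (Fin 0)
  | n + 1 => EuclideanHalfSpace (n + 1)

instance BoundaryModelSpace.instTopologicalSpace :
    (n : ℕ) → TopologicalSpace (BoundaryModelSpace n)
  | 0 => inferInstanceAs (TopologicalSpace (EuclideanSpace ℝ (Fin 0)))
  | n + 1 => inferInstanceAs (TopologicalSpace (EuclideanHalfSpace (n + 1)))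

/-- The model with corners for smooth `n`-dimensional manifolds with boundary. -/
noncomputable def boundaryModel :
    (n : ℕ) → ModelWithCorners ℝ (EuclideanSpace ℝ (Fin n)) (BoundaryModelSpace n)
  | 0 => 𝓡 0
  | n + 1 => 𝓡∂ (n + 1)

/-! ### Pulling back a manifold structure along a local homeomorphism -/

namespace LocalHomeoPullback

variable {H M N : Type*} [TopologicalSpace H] [TopologicalSpace M] [TopologicalSpace N]

/-- The charted space structure on the source of a local homeomorphism `p : N → M`: the charts
are the compositions of the local branches of `p` with the charts of `M`. -/
@[reducible]
noncomputable def chartedSpace [ChartedSpace H M] {p : N → M} (hp : IsLocalHomeomorph p) :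
    ChartedSpace H N where
  atlas := {c | ∃ e : OpenPartialHomeomorph N M, p = e ∧ ∃ a ∈ atlas H M, c = e ≫ₕ a}
  chartAt x := (hp x).choose ≫ₕ chartAt H (p x)
  mem_chart_source x := by
    have h := (hp x).choose_spec
    refine ⟨h.1, ?_⟩
    have : (hp x).choose x = p x := (congrFun h.2 x).symm
    simp only [Set.mem_preimage]
    erw [this]
    exact mem_chart_source H (p x)
  chart_mem_atlas x := ⟨_, (hp x).choose_spec.2, _, chart_mem_atlas H (p x), rfl⟩

lemma hasGroupoid [ChartedSpace H M] {p : N → M} (hp : IsLocalHomeomorph p)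
    (𝒢 : StructureGroupoid H) [ClosedUnderRestriction 𝒢] [HasGroupoid M 𝒢] :
    @HasGroupoid H _ N _ (chartedSpace hp) 𝒢 := by
  let _ := chartedSpace (H := H) hp
  refine ⟨?_⟩
  rintro _ _ ⟨e, he, a, ha, rfl⟩ ⟨e', he', a', ha', rfl⟩
  have key := 𝒢.compatible ha ha'
  have hopen : IsOpen ((e ≫ₕ a).symm ≫ₕ (e' ≫ₕ a')).source :=
    ((e ≫ₕ a).symm ≫ₕ (e' ≫ₕ a')).open_source
  refine 𝒢.mem_of_eqOnSource (closedUnderRestriction' key hopen) ?_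
  have heq : ∀ y ∈ e.target, e' (e.symm y) = y := by
    intro y hy
    rw [← he', he]
    exact e.right_inv hy
  constructor
  · ext y
    simp only [OpenPartialHomeomorph.restr_source, hopen.interior_eq]
    constructor
    · intro hy
      refine ⟨?_, hy⟩
      simp only [mfld_simps] at hy ⊢
      rw [heq _ hy.1.2] at hy
      exact ⟨hy.1.1, hy.2.2⟩
    · exact fun hy => hy.2
  · intro y hy
    simp only [mfld_simps] at hy ⊢
    rw [heq _ hy.1.2]

variable {E : Type*} [NormedAddCommGroup E] [NormedSpace ℝ E]

lemma isManifold [ChartedSpace H M] {p : N → M} (hp : IsLocalHomeomorph p)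
    (I : ModelWithCorners ℝ E H) (k : WithTop ℕ∞) [IsManifold I k M] :
    @IsManifold ℝ _ E _ _ H _ I k N _ (chartedSpace hp) :=
  let _ := chartedSpace (H := H) hp
  have := hasGroupoid (H := H) hp (contDiffGroupoid k I)
  IsManifold.mk' I k N

lemma extChartAt_eq [ChartedSpace H M] {p : N → M} (hp : IsLocalHomeomorph p)
    (I : ModelWithCorners ℝ E H) (x y : N) :
    let _ := chartedSpace (H := H) hp
    extChartAt I x y = extChartAt I (p x) (p y) := by
  let _ := chartedSpace (H := H) hp
  have h := (hp x).choose_spec.2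
  have h' : (hp x).choose y = p y := (congrFun h y).symm
  change I (chartAt H (p x) ((hp x).choose y)) = I (chartAt H (p x) (p y))
  rw [h']

lemma contMDiff_proj [ChartedSpace H M] {p : N → M} (hp : IsLocalHomeomorph p)
    (I : ModelWithCorners ℝ E H) (k : WithTop ℕ∞) [IsManifold I k M] :
    @ContMDiff ℝ _ E _ _ H _ I N _ (chartedSpace hp) E _ _ H _ I M _ _ k p := by
  let _ := chartedSpace (H := H) hp
  have := isManifold hp I k
  intro x
  rw [contMDiffAt_iff_target]
  refine ⟨hp.continuous.continuousAt, ?_⟩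
  have : extChartAt I (p x) ∘ p = extChartAt I x := by
    funext y
    exact (extChartAt_eq hp I x y).symm
  rw [this]
  exact contMDiffAt_extChartAt

lemma contMDiff_of_proj [ChartedSpace H M] {p : N → M} (hp : IsLocalHomeomorph p)
    (I : ModelWithCorners ℝ E H) (k : WithTop ℕ∞)
    {E' H' P : Type*} [NormedAddCommGroup E'] [NormedSpace ℝ E'] [TopologicalSpace H']
    {J : ModelWithCorners ℝ E' H'} [TopologicalSpace P] [ChartedSpace H' P]
    {φ : P → N} (hφ : Continuous φ) (h : ContMDiff J I k (p ∘ φ)) :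
    @ContMDiff ℝ _ E' _ _ H' _ J P _ _ E _ _ H _ I N _ (chartedSpace hp) k φ := by
  let _ := chartedSpace (H := H) hp
  intro x
  rw [contMDiffAt_iff_target]
  refine ⟨hφ.continuousAt, ?_⟩
  have : extChartAt I (φ x) ∘ φ = extChartAt I (p (φ x)) ∘ (p ∘ φ) := by
    funext y
    exact extChartAt_eq hp I (φ x) (φ y)
  rw [this]
  exact (contMDiffAt_iff_target.1 (h x)).2

end LocalHomeoPullback

/-! ### Compact smooth `G`-manifolds with boundary -/

/-- A compact smooth `n`-dimensional manifold, possibly with boundary (and possibly empty),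
with a smooth action of the finite group `G`. -/
structure GManifold (G : Type u) [Group G] (n : ℕ) : Type (u + 1) where
  carrier : Type u
  [topologicalSpace : TopologicalSpace carrier]
  [t2Space : T2Space carrier]
  [compactSpace : CompactSpace carrier]
  [chartedSpace : ChartedSpace (BoundaryModelSpace n) carrier]
  [isManifold : IsManifold (boundaryModel n) ∞ carrier]
  [mulAction : MulAction G carrier]
  contMDiff_smul : ∀ g : G,
    ContMDiff (boundaryModel n) (boundaryModel n) ∞ (fun m : carrier => g • m)

namespace GManifold

variable {G : Type u} [Group G] {n : ℕ}

instance : CoeSort (GManifold G n) (Type u) := ⟨GManifold.carrier⟩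

attribute [instance] topologicalSpace t2Space compactSpace chartedSpace isManifold mulAction

/-- The boundary `∂M`. -/
def boundary (M : GManifold G n) : Set M := (boundaryModel n).boundary M

/-- A `G`-diffeomorphism. -/
structure GDiffeo (M N : GManifold G n) where
  toDiffeo : Diffeomorph (boundaryModel n) (boundaryModel n) M N ∞
  map_smul : ∀ (g : G) (m : M), toDiffeo (g • m) = g • toDiffeo m

/-- A smooth `G`-embedding of a `G`-manifold into a `G`-manifold of the same dimension. (Boundary
points are allowed to go to interior points.) -/
structure IsGEmbedding {M N : GManifold G n} (i : M → N) : Prop where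
  isEmbedding : IsEmbedding i
  contMDiff : ContMDiff (boundaryModel n) (boundaryModel n) ∞ i
  injective_mfderiv : ∀ x : M,
    Function.Injective (mfderiv (boundaryModel n) (boundaryModel n) i x)
  map_smul : ∀ (g : G) (m : M), i (g • m) = g • i m

/-- `S` is a union of components of the boundary of `M`: a subset of `∂M` that is open and closed
in `∂M`. -/
structure IsBoundaryPart (M : GManifold G n) (S : Set M) : Prop where
  subset : S ⊆ M.boundary
  isClosed : IsClosed S
  isOpen : ∃ U : Set M, IsOpen U ∧ S = M.boundary ∩ U

/-- `M = M₁ ∪_φ M₂`: the `G`-manifold `M` is obtained by pasting `M₁` and `M₂` along parts `S₁` and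
`S₂` of their boundaries. The inclusions of the two pieces are `i₁` and `i₂`; the cut is the
`G`-invariant hypersurface `Σ = i₁(S₁) = i₂(S₂)`, disjoint from `∂M`, and the equivariant pasting
diffeomorphism is `φ = i₂⁻¹ ∘ i₁ : S₁ → S₂`. Since `Σ` separates the two `G`-invariant sides `i₁(M₁)`
and `i₂(M₂)`, its normal bundle is trivial and `G` acts trivially on the normal direction; conversely
every hypersurface with such a normal bundle that separates `M` arises in this way. -/
structure IsPasting (M M₁ M₂ : GManifold G n) (S₁ : Set M₁) (S₂ : Set M₂)
    (i₁ : M₁ → M) (i₂ : M₂ → M) : Prop where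
  isBoundaryPart₁ : M₁.IsBoundaryPart S₁
  isBoundaryPart₂ : M₂.IsBoundaryPart S₂
  isGEmbedding₁ : IsGEmbedding i₁
  isGEmbedding₂ : IsGEmbedding i₂
  union_range : Set.range i₁ ∪ Set.range i₂ = Set.univ
  inter_range : Set.range i₁ ∩ Set.range i₂ = i₁ '' S₁
  image_eq : i₁ '' S₁ = i₂ '' S₂
  disjoint_boundary : Disjoint (i₁ '' S₁) M.boundary

end GManifold

/-- `f` and `f'` are `G`-homotopic maps from `M` to the `G`-space `X`. -/
def GHomotopic (G : Type*) {M X : Type*} [TopologicalSpace M] [TopologicalSpace X]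
    [SMul G M] [SMul G X] (f f' : M → X) : Prop :=
  ∃ h : unitInterval × M → X, Continuous h ∧ (∀ m, h (0, m) = f m) ∧ (∀ m, h (1, m) = f' m) ∧
    ∀ (t : unitInterval) (g : G) (m : M), h (t, g • m) = g • h (t, m)

/-! ### Singular `G`-manifolds and the groups `SK^G(X)` -/

/-- A pair `(M, f)` of a compact smooth `n`-dimensional `G`-manifold with boundary `M` and a
continuous `G`-map `f` from `M` to the `G`-space `X`. -/
structure SingularGManifold (G : Type u) [Group G] (n : ℕ) (X : Type u) [TopologicalSpace X]
    [MulAction G X] : Type (u + 1) extends GManifold G n where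
  f : carrier → X
  continuous_f : Continuous f
  f_smul : ∀ (g : G) (m : carrier), f (g • m) = g • f m

namespace SingularGManifold

variable {G : Type u} [Group G] {n : ℕ} {X : Type u} [TopologicalSpace X] [MulAction G X]

instance : CoeSort (SingularGManifold G n X) (Type u) := ⟨fun M => M.carrier⟩

/-- `(M, f) ∼ (M', f')`: there is a `G`-diffeomorphism `φ : M → M'` with `f' ∘ φ = f`. -/
def Rel (A B : SingularGManifold G n X) : Prop :=
  ∃ φ : GManifold.GDiffeo A.toGManifold B.toGManifold, ∀ m : A, B.f (φ.toDiffeo m) = A.f m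

variable (G n X) in
/-- The equivalence relation `∼` on pairs `(M, f)`. -/
def setoid : Setoid (SingularGManifold G n X) where
  r := Rel
  iseqv :=
    { refl := fun A => ⟨⟨Diffeomorph.refl _ A ∞, fun _ _ => rfl⟩, fun _ => rfl⟩
      symm := by
        rintro A B ⟨φ, h⟩
        refine ⟨⟨φ.toDiffeo.symm, fun g m => ?_⟩, fun m => ?_⟩
        · apply φ.toDiffeo.injective
          have := φ.map_smul g (φ.toDiffeo.symm m)
          simp only [Diffeomorph.apply_symm_apply] at this
          exact (φ.toDiffeo.apply_symm_apply _).trans this.symm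
        · rw [← h]
          simp
      trans := by
        rintro A B C ⟨φ, h⟩ ⟨ψ, k⟩
        refine ⟨⟨φ.toDiffeo.trans ψ.toDiffeo, fun g m => ?_⟩, fun m => ?_⟩
        · simp [φ.map_smul, ψ.map_smul]
        · simp [h, k] }

/-- The disjoint union of two singular manifolds. -/
noncomputable def sum (A B : SingularGManifold G n X) : SingularGManifold G n X where
  carrier := A ⊕ B
  contMDiff_smul g := (A.contMDiff_smul g).sumMap (B.contMDiff_smul g)
  f := Sum.elim A.f B.f
  continuous_f := A.continuous_f.sumElim B.continuous_f
  f_smul := by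
    rintro g (m | m)
    · exact A.f_smul g m
    · exact B.f_smul g m

variable (G n X) in
/-- The empty singular manifold. -/
noncomputable def empty : SingularGManifold G n X :=
  letI : ChartedSpace (BoundaryModelSpace n) PEmpty.{u + 1} := ChartedSpace.empty _ _
  letI : MulAction G PEmpty.{u + 1} :=
    { smul := fun _ m => m.elim, one_smul := fun m => m.elim, mul_smul := fun _ _ m => m.elim }
  { carrier := PEmpty.{u + 1}
    isManifold := IsManifold.empty _
    contMDiff_smul := fun _ m => m.elim
    f := fun m => m.elim
    continuous_f := continuous_of_discreteTopology
    f_smul := fun _ m => m.elim }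

instance : IsEmpty (empty G n X) := inferInstanceAs (IsEmpty PEmpty)

/-- `(A, f)` and `(B, f')` are obtained from each other by a `G`-SK-operation in `X`:
`A = M₁ ∪_φ M₂` and `B = M₁ ∪_ψ M₂` for two pastings along the same parts of the boundaries of `M₁`
and `M₂`, and the restrictions of `f` and `f'` to `M₁` and to `M₂` are `G`-homotopic. -/
def SKOperation (A B : SingularGManifold G n X) : Prop :=
  ∃ (M₁ M₂ : GManifold G n) (S₁ : Set M₁) (S₂ : Set M₂)
    (i₁ : M₁ → A) (i₂ : M₂ → A) (j₁ : M₁ → B) (j₂ : M₂ → B),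
    A.toGManifold.IsPasting M₁ M₂ S₁ S₂ i₁ i₂ ∧ B.toGManifold.IsPasting M₁ M₂ S₁ S₂ j₁ j₂ ∧
    GHomotopic G (A.f ∘ i₁) (B.f ∘ j₁) ∧ GHomotopic G (A.f ∘ i₂) (B.f ∘ j₂)

/-- `G`-SK-equivalence in `X`: one is obtained from the other by a finite sequence of
`G`-SK-operations in `X`. -/
def SKEquivalent : SingularGManifold G n X → SingularGManifold G n X → Prop :=
  Relation.ReflTransGen SKOperation

end SingularGManifold

/-- The monoid `𝓜^G(X)` of equivalence classes of singular `n`-manifolds in `X` under disjoint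
union. -/
def SingularMonoid (G : Type u) [Group G] (n : ℕ) (X : Type u) [TopologicalSpace X]
    [MulAction G X] : Type (u + 1) :=
  Quotient (SingularGManifold.setoid G n X)

namespace SingularMonoid

open SingularGManifold

variable {G : Type u} [Group G] {n : ℕ} {X : Type u} [TopologicalSpace X] [MulAction G X]

/-- The class of a singular manifold. -/
def mk (A : SingularGManifold G n X) : SingularMonoid G n X :=
  Quotient.mk (SingularGManifold.setoid G n X) A

noncomputable instance : Add (SingularMonoid G n X) where
  add := Quotient.map₂ (sa := setoid G n X) (sb := setoid G n X) (sc := setoid G n X)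
    SingularGManifold.sum (by
    rintro A A' ⟨φ, h⟩ B B' ⟨ψ, k⟩
    refine ⟨⟨Diffeomorph.sumCongr φ.toDiffeo ψ.toDiffeo, ?_⟩, ?_⟩
    · rintro g (m | m)
      · exact congrArg Sum.inl (φ.map_smul g m)
      · exact congrArg Sum.inr (ψ.map_smul g m)
    · rintro (m | m)
      · exact h m
      · exact k m)

noncomputable instance : Zero (SingularMonoid G n X) where
  zero := mk (SingularGManifold.empty G n X)

noncomputable instance : AddCommMonoid (SingularMonoid G n X) where
  add_assoc := by
    rintro ⟨A⟩ ⟨B⟩ ⟨C⟩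
    refine Quotient.sound ⟨⟨Diffeomorph.sumAssoc _ A ∞ B C, ?_⟩, ?_⟩
    · rintro g ((m | m) | m) <;> rfl
    · rintro ((m | m) | m) <;> rfl
  zero_add := by
    rintro ⟨A⟩
    refine Quotient.sound ⟨⟨(Diffeomorph.sumComm _ _ ∞ _).trans
      (Diffeomorph.sumEmpty _ A ∞ (M' := SingularGManifold.empty G n X)), ?_⟩, ?_⟩
    · rintro g (m | m)
      · exact isEmptyElim m
      · rfl
    · rintro (m | m)
      · exact isEmptyElim m
      · rfl
  add_zero := by
    rintro ⟨A⟩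
    refine Quotient.sound ⟨⟨
      (Diffeomorph.sumEmpty _ A ∞ (M' := SingularGManifold.empty G n X)), ?_⟩, ?_⟩
    · rintro g (m | m)
      · rfl
      · exact isEmptyElim m
    · rintro (m | m)
      · rfl
      · exact isEmptyElim m
  add_comm := by
    rintro ⟨A⟩ ⟨B⟩
    refine Quotient.sound ⟨⟨Diffeomorph.sumComm _ A ∞ B, ?_⟩, ?_⟩
    · rintro g (m | m) <;> rfl
    · rintro (m | m) <;> rfl
  nsmul := nsmulRec

end SingularMonoid

/-- The subgroup of the group completion of `𝓜^G(X)` generated by the differences of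
`G`-SK-equivalent singular manifolds. -/
noncomputable def skRelations (G : Type u) [Group G] (n : ℕ) (X : Type u) [TopologicalSpace X]
    [MulAction G X] : AddSubgroup (Algebra.GrothendieckAddGroup (SingularMonoid G n X)) :=
  AddSubgroup.closure {x | ∃ A B : SingularGManifold G n X, A.SKEquivalent B ∧
    x = Algebra.GrothendieckAddGroup.of (SingularMonoid.mk A) -
      Algebra.GrothendieckAddGroup.of (SingularMonoid.mk B)}

/-- The group `SK^G(X)` of singular compact `n`-dimensional `G`-manifolds with boundary in the
`G`-space `X`: the quotient of the group completion of `𝓜^G(X)` by `G`-SK-equivalence in `X`. -/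
def SK (G : Type u) [Group G] (n : ℕ) (X : Type u) [TopologicalSpace X] [MulAction G X] :
    Type (u + 1) :=
  Algebra.GrothendieckAddGroup (SingularMonoid G n X) ⧸ skRelations G n X

namespace SK

variable {G : Type u} [Group G] {n : ℕ} {X : Type u} [TopologicalSpace X] [MulAction G X]

noncomputable instance : AddCommGroup (SK G n X) :=
  inferInstanceAs (AddCommGroup (Algebra.GrothendieckAddGroup (SingularMonoid G n X) ⧸
    skRelations G n X))

/-- The class `[M, f]` in `SK^G(X)`. -/
noncomputable def mk (A : SingularGManifold G n X) : SK G n X :=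
  QuotientAddGroup.mk (Algebra.GrothendieckAddGroup.of (SingularMonoid.mk A))

end SK

/-- The group `SK^G = SK^G(pt)` of compact `n`-dimensional `G`-manifolds with boundary. -/
abbrev SKPoint (G : Type u) [Group G] (n : ℕ) : Type (u + 1) := SK G n PUnit.{u + 1}

/-! ### Finite `G`-sets, spans and the Burnside category -/

/-- A finite `G`-set. -/
structure FinGSet (G : Type u) [Group G] : Type (u + 1) where
  carrier : Type u
  [mulAction : MulAction G carrier]
  [finite : Finite carrier]

namespace FinGSet

variable {G : Type u} [Group G]

instance : CoeSort (FinGSet G) (Type u) := ⟨FinGSet.carrier⟩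

attribute [instance] mulAction finite

/-- Finite `G`-sets are regarded as discrete `G`-spaces. -/
instance (X : FinGSet G) : TopologicalSpace X := ⊥

instance (X : FinGSet G) : DiscreteTopology X := ⟨rfl⟩

/-- The orbit `G/H`. -/
def orbit [Finite G] (H : Subgroup G) : FinGSet G where
  carrier := G ⧸ H

/-- The base point `eH` of `G/H`. -/
def orbitBase [Finite G] (H : Subgroup G) : orbit H := ((1 : G) : G ⧸ H)

/-- The empty `G`-set. -/
def empty (G : Type u) [Group G] : FinGSet G :=
  letI : MulAction G PEmpty.{u + 1} :=
    { smul := fun _ m => m.elim, one_smul := fun m => m.elim, mul_smul := fun _ _ m => m.elim }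
  { carrier := PEmpty.{u + 1} }

instance : IsEmpty (empty G) := inferInstanceAs (IsEmpty PEmpty)

/-- The disjoint union of two finite `G`-sets. -/
def sum (X Y : FinGSet G) : FinGSet G where
  carrier := X ⊕ Y

/-- The pullback `{(u, v) ∈ U × V | β(u) = γ(v)}` of finite `G`-sets. -/
def pullback {U V Y : FinGSet G} (β : U →[G] Y) (γ : V →[G] Y) : FinGSet G :=
  letI : MulAction G {p : U × V // β p.1 = γ p.2} :=
    { smul := fun g p => ⟨(g • p.1.1, g • p.1.2), by rw [map_smul, map_smul, p.2]⟩
      one_smul := fun p => Subtype.ext (Prod.ext (one_smul G p.1.1) (one_smul G p.1.2))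
      mul_smul := fun g h p =>
        Subtype.ext (Prod.ext (mul_smul g h p.1.1) (mul_smul g h p.1.2)) }
  { carrier := {p : U × V // β p.1 = γ p.2} }

end FinGSet

/-- A span `X ← U → Y` of finite `G`-sets. -/
structure GSpan {G : Type u} [Group G] (X Y : FinGSet G) : Type (u + 1) where
  apex : FinGSet G
  left : apex →[G] X
  right : apex →[G] Y

namespace GSpan

variable {G : Type u} [Group G] {X Y Z W : FinGSet G}

/-- Two spans are equivalent if there is an isomorphism of their apexes that commutes with both
legs. -/
def Rel (s t : GSpan X Y) : Prop :=
  ∃ e : s.apex ≃ t.apex, (∀ (g : G) (u : s.apex), e (g • u) = g • e u) ∧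
    (∀ u, t.left (e u) = s.left u) ∧ ∀ u, t.right (e u) = s.right u

variable (X Y) in
/-- The equivalence relation on spans. -/
def setoid : Setoid (GSpan X Y) where
  r := Rel
  iseqv :=
    { refl := fun _ => ⟨Equiv.refl _, fun _ _ => rfl, fun _ => rfl, fun _ => rfl⟩
      symm := by
        rintro s t ⟨e, h, hl, hr⟩
        refine ⟨e.symm, fun g u => ?_, fun u => ?_, fun u => ?_⟩
        · rw [Equiv.symm_apply_eq, h, Equiv.apply_symm_apply]
        · rw [← hl, Equiv.apply_symm_apply]
        · rw [← hr, Equiv.apply_symm_apply]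
      trans := by
        rintro s t r ⟨e, h, hl, hr⟩ ⟨e', h', hl', hr'⟩
        refine ⟨e.trans e', fun g u => ?_, fun u => ?_, fun u => ?_⟩
        · simp [h, h']
        · simp [hl, hl']
        · simp [hr, hr'] }

/-- The identity span. -/
def id (X : FinGSet G) : GSpan X X := ⟨X, MulActionHom.id G, MulActionHom.id G⟩

/-- Composition of spans by pullback. -/
def comp (s : GSpan X Y) (t : GSpan Y Z) : GSpan X Z where
  apex := FinGSet.pullback s.right t.left
  left :=
    { toFun := fun p => s.left p.1.1
      map_smul' := fun g p => map_smul s.left g p.1.1 }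
  right :=
    { toFun := fun p => t.right p.1.2
      map_smul' := fun g p => map_smul t.right g p.1.2 }

/-- The sum `X ← U ⊔ V → Y` of spans `X ← U → Y` and `X ← V → Y`. -/
def sum (s t : GSpan X Y) : GSpan X Y where
  apex := s.apex.sum t.apex
  left :=
    { toFun := Sum.elim s.left t.left
      map_smul' := by
        rintro g (u | u)
        · exact map_smul s.left g u
        · exact map_smul t.left g u }
  right :=
    { toFun := Sum.elim s.right t.right
      map_smul' := by
        rintro g (u | u)
        · exact map_smul s.right g u
        · exact map_smul t.right g u }

variable (X Y) in
/-- The span `X ← ∅ → Y`. -/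
def zero : GSpan X Y where
  apex := FinGSet.empty G
  left := { toFun := fun u => isEmptyElim u, map_smul' := fun _ u => isEmptyElim u }
  right := { toFun := fun u => isEmptyElim u, map_smul' := fun _ u => isEmptyElim u }

end GSpan

/-- Morphisms of the span category of finite `G`-sets: equivalence classes of spans. -/
def SpanClass {G : Type u} [Group G] (X Y : FinGSet G) : Type (u + 1) :=
  Quotient (GSpan.setoid X Y)

namespace SpanClass

open GSpan

variable {G : Type u} [Group G] {X Y Z W : FinGSet G}

/-- The class of a span. -/
def mk (s : GSpan X Y) : SpanClass X Y := Quotient.mk (GSpan.setoid X Y) s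

instance : Add (SpanClass X Y) where
  add := Quotient.map₂ (sa := setoid X Y) (sb := setoid X Y) (sc := setoid X Y) GSpan.sum (by
    rintro s s' ⟨e, h, hl, hr⟩ t t' ⟨e', h', hl', hr'⟩
    refine ⟨Equiv.sumCongr e e', ?_, ?_, ?_⟩
    · rintro g (u | u)
      · exact congrArg Sum.inl (h g u)
      · exact congrArg Sum.inr (h' g u)
    · rintro (u | u)
      · exact hl u
      · exact hl' u
    · rintro (u | u)
      · exact hr u
      · exact hr' u)

instance : Zero (SpanClass X Y) where
  zero := mk (GSpan.zero X Y)

/-- The commutative monoid structure given by disjoint union of spans. -/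
instance : AddCommMonoid (SpanClass X Y) where
  add_assoc := by
    rintro ⟨s⟩ ⟨t⟩ ⟨r⟩
    refine Quotient.sound ⟨Equiv.sumAssoc s.apex t.apex r.apex, ?_, ?_, ?_⟩
    · rintro g ((u | u) | u) <;> rfl
    · rintro ((u | u) | u) <;> rfl
    · rintro ((u | u) | u) <;> rfl
  zero_add := by
    rintro ⟨s⟩
    refine Quotient.sound ⟨Equiv.emptySum (FinGSet.empty G) s.apex, ?_, ?_, ?_⟩
    · rintro g (u | u)
      · exact isEmptyElim (α := FinGSet.empty G) u
      · rfl
    · rintro (u | u)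
      · exact isEmptyElim (α := FinGSet.empty G) u
      · rfl
    · rintro (u | u)
      · exact isEmptyElim (α := FinGSet.empty G) u
      · rfl
  add_zero := by
    rintro ⟨s⟩
    refine Quotient.sound ⟨Equiv.sumEmpty s.apex (FinGSet.empty G), ?_, ?_, ?_⟩
    · rintro g (u | u)
      · rfl
      · exact isEmptyElim (α := FinGSet.empty G) u
    · rintro (u | u)
      · rfl
      · exact isEmptyElim (α := FinGSet.empty G) u
    · rintro (u | u)
      · rfl
      · exact isEmptyElim (α := FinGSet.empty G) u
  add_comm := by
    rintro ⟨s⟩ ⟨t⟩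
    refine Quotient.sound ⟨Equiv.sumComm s.apex t.apex, ?_, ?_, ?_⟩
    · rintro g (u | u) <;> rfl
    · rintro (u | u) <;> rfl
    · rintro (u | u) <;> rfl
  nsmul := nsmulRec

/-- Composition of classes of spans. -/
def comp : SpanClass X Y → SpanClass Y Z → SpanClass X Z :=
  Quotient.map₂ (sa := setoid X Y) (sb := setoid Y Z) (sc := setoid X Z) GSpan.comp (by
    rintro s s' ⟨e, h, hl, hr⟩ t t' ⟨e', h', hl', hr'⟩
    refine ⟨(Equiv.prodCongr e e').subtypeEquiv (fun p => ?_), ?_, ?_, ?_⟩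
    · simp [hr, hl']
    · rintro g ⟨⟨u, v⟩, p⟩
      exact Subtype.ext (Prod.ext (h g u) (h' g v))
    · rintro ⟨⟨u, v⟩, p⟩
      exact hl u
    · rintro ⟨⟨u, v⟩, p⟩
      exact hr' v)

lemma comp_assoc (a : SpanClass X Y) (b : SpanClass Y Z) (c : SpanClass Z W) :
    (a.comp b).comp c = a.comp (b.comp c) := by
  obtain ⟨s⟩ := a
  obtain ⟨t⟩ := b
  obtain ⟨r⟩ := c
  refine Quotient.sound ⟨⟨fun p => ⟨(p.1.1.1.1, ⟨(p.1.1.1.2, p.1.2), p.2⟩), p.1.1.2⟩,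
    fun p => ⟨(⟨(p.1.1, p.1.2.1.1), p.2⟩, p.1.2.1.2), p.1.2.2⟩, fun _ => rfl, fun _ => rfl⟩,
    fun _ _ => rfl, fun _ => rfl, fun _ => rfl⟩

lemma id_comp (a : SpanClass X Y) : (mk (GSpan.id X)).comp a = a := by
  obtain ⟨s⟩ := a
  refine Quotient.sound ⟨⟨fun p => p.1.2, fun u => ⟨(s.left u, u), rfl⟩, ?_, fun _ => rfl⟩,
    fun _ _ => rfl, ?_, fun _ => rfl⟩
  · rintro ⟨⟨x, u⟩, p⟩
    exact Subtype.ext (Prod.ext p.symm rfl)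
  · rintro ⟨⟨x, u⟩, p⟩
    exact p.symm

lemma comp_id (a : SpanClass X Y) : a.comp (mk (GSpan.id Y)) = a := by
  obtain ⟨s⟩ := a
  refine Quotient.sound ⟨⟨fun p => p.1.1, fun u => ⟨(u, s.right u), rfl⟩, ?_, fun _ => rfl⟩,
    fun _ _ => rfl, fun _ => rfl, ?_⟩
  · rintro ⟨⟨u, y⟩, p⟩
    exact Subtype.ext (Prod.ext rfl p)
  · rintro ⟨⟨u, y⟩, p⟩
    exact p

lemma zero_comp (b : SpanClass Y Z) : (0 : SpanClass X Y).comp b = 0 := by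
  obtain ⟨t⟩ := b
  refine Quotient.sound ⟨⟨fun p => p.1.1, fun u => isEmptyElim (α := FinGSet.empty G) u,
    fun p => isEmptyElim (α := FinGSet.empty G) p.1.1,
    fun u => isEmptyElim (α := FinGSet.empty G) u⟩,
    fun _ p => isEmptyElim (α := FinGSet.empty G) p.1.1,
    fun p => isEmptyElim (α := FinGSet.empty G) p.1.1,
    fun p => isEmptyElim (α := FinGSet.empty G) p.1.1⟩

lemma comp_zero (a : SpanClass X Y) : a.comp (0 : SpanClass Y Z) = 0 := by
  obtain ⟨s⟩ := a
  refine Quotient.sound ⟨⟨fun p => p.1.2, fun u => isEmptyElim (α := FinGSet.empty G) u,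
    fun p => isEmptyElim (α := FinGSet.empty G) p.1.2,
    fun u => isEmptyElim (α := FinGSet.empty G) u⟩,
    fun _ p => isEmptyElim (α := FinGSet.empty G) p.1.2,
    fun p => isEmptyElim (α := FinGSet.empty G) p.1.2,
    fun p => isEmptyElim (α := FinGSet.empty G) p.1.2⟩

lemma add_comp (a a' : SpanClass X Y) (b : SpanClass Y Z) :
    (a + a').comp b = a.comp b + a'.comp b := by
  obtain ⟨s⟩ := a
  obtain ⟨s'⟩ := a'
  obtain ⟨t⟩ := b
  refine Quotient.sound ⟨⟨
    fun p => match p with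
      | ⟨(Sum.inl u, v), h⟩ => Sum.inl ⟨(u, v), h⟩
      | ⟨(Sum.inr u, v), h⟩ => Sum.inr ⟨(u, v), h⟩,
    fun q => match q with
      | Sum.inl ⟨(u, v), h⟩ => ⟨(Sum.inl u, v), h⟩
      | Sum.inr ⟨(u, v), h⟩ => ⟨(Sum.inr u, v), h⟩, ?_, ?_⟩, ?_, ?_, ?_⟩
  · rintro ⟨⟨u | u, v⟩, h⟩ <;> rfl
  · rintro (⟨⟨u, v⟩, h⟩ | ⟨⟨u, v⟩, h⟩) <;> rfl
  · rintro g ⟨⟨u | u, v⟩, h⟩ <;> rfl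
  · rintro ⟨⟨u | u, v⟩, h⟩ <;> rfl
  · rintro ⟨⟨u | u, v⟩, h⟩ <;> rfl

lemma comp_add (a : SpanClass X Y) (b b' : SpanClass Y Z) :
    a.comp (b + b') = a.comp b + a.comp b' := by
  obtain ⟨s⟩ := a
  obtain ⟨t⟩ := b
  obtain ⟨t'⟩ := b'
  refine Quotient.sound ⟨⟨
    fun p => match p with
      | ⟨(u, Sum.inl v), h⟩ => Sum.inl ⟨(u, v), h⟩
      | ⟨(u, Sum.inr v), h⟩ => Sum.inr ⟨(u, v), h⟩,
    fun q => match q with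
      | Sum.inl ⟨(u, v), h⟩ => ⟨(u, Sum.inl v), h⟩
      | Sum.inr ⟨(u, v), h⟩ => ⟨(u, Sum.inr v), h⟩, ?_, ?_⟩, ?_, ?_, ?_⟩
  · rintro ⟨⟨u, v | v⟩, h⟩ <;> rfl
  · rintro (⟨⟨u, v⟩, h⟩ | ⟨⟨u, v⟩, h⟩) <;> rfl
  · rintro g ⟨⟨u, v | v⟩, h⟩ <;> rfl
  · rintro ⟨⟨u, v | v⟩, h⟩ <;> rfl
  · rintro ⟨⟨u, v | v⟩, h⟩ <;> rfl

/-- Composition of classes of spans as a biadditive map. -/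
def compHom : SpanClass X Y →+ SpanClass Y Z →+ SpanClass X Z where
  toFun a :=
    { toFun := fun b => a.comp b
      map_zero' := comp_zero a
      map_add' := comp_add a }
  map_zero' := by
    ext b
    exact zero_comp b
  map_add' a a' := by
    ext b
    exact add_comp a a' b

end SpanClass

namespace GroupCompletion

open Algebra

variable {A B C : Type*} [AddCommMonoid A] [AddCommMonoid B] [AddCommMonoid C]

lemma induction {p : GrothendieckAddGroup A → Prop}
    (hof : ∀ a, p (GrothendieckAddGroup.of a)) (hsub : ∀ x y, p x → p y → p (x - y)) :
    ∀ x, p x := by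
  intro x
  obtain ⟨⟨a, b⟩, h⟩ := (AddLocalization.addMonoidOf (⊤ : AddSubmonoid A)).surj x
  have : x = GrothendieckAddGroup.of a - GrothendieckAddGroup.of (b : A) := eq_sub_of_add_eq h
  rw [this]
  exact hsub _ _ (hof a) (hof b)

lemma lift_of {D : Type*} [AddCommGroup D] (f : A →+ D) (a : A) :
    GrothendieckAddGroup.lift f (GrothendieckAddGroup.of a) = f a :=
  DFunLike.congr_fun (GrothendieckAddGroup.lift.symm_apply_apply f) a

/-- The extension of a biadditive map to the group completions. -/
noncomputable def lift₂ (m : A →+ B →+ C) :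
    GrothendieckAddGroup A →+ GrothendieckAddGroup B →+ GrothendieckAddGroup C :=
  GrothendieckAddGroup.lift
    { toFun := fun a => GrothendieckAddGroup.lift (GrothendieckAddGroup.of.comp (m a))
      map_zero' := by
        ext x
        induction x using induction with
        | hof b => rw [lift_of, map_zero, AddMonoidHom.comp_zero, AddMonoidHom.zero_apply,
            AddMonoidHom.zero_apply]
        | hsub x y hx hy => rw [map_sub, map_sub, hx, hy]
      map_add' := fun a a' => by
        ext x
        induction x using induction with
        | hof b =>
          rw [AddMonoidHom.add_apply]
          simp only [lift_of, AddMonoidHom.comp_apply, map_add, AddMonoidHom.add_apply]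
        | hsub x y hx hy => rw [map_sub, map_sub, hx, hy] }

lemma lift₂_of (m : A →+ B →+ C) (a : A) (b : B) :
    lift₂ m (GrothendieckAddGroup.of a) (GrothendieckAddGroup.of b) =
      GrothendieckAddGroup.of (m a b) := by
  rw [lift₂, lift_of]
  exact lift_of _ _

end GroupCompletion

/-- The Burnside category `𝓑_G`: its objects are the finite `G`-sets, and its morphisms from `X` to
`Y` form the group completion of the monoid of equivalence classes of spans `X ← U → Y`. -/
structure BurnsideCat (G : Type u) [Group G] : Type (u + 1) where
  of ::
  toFinGSet : FinGSet G

namespace BurnsideCat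

open Algebra

variable {G : Type u} [Group G]

noncomputable instance : Category.{u + 1} (BurnsideCat G) where
  Hom X Y := GrothendieckAddGroup (SpanClass X.toFinGSet Y.toFinGSet)
  id X := GrothendieckAddGroup.of (SpanClass.mk (GSpan.id X.toFinGSet))
  comp f g := GroupCompletion.lift₂ SpanClass.compHom f g
  id_comp {X Y} f := by
    induction f using GroupCompletion.induction with
    | hof a =>
      rw [GroupCompletion.lift₂_of]
      exact congrArg GrothendieckAddGroup.of (SpanClass.id_comp a)
    | hsub x y hx hy => rw [map_sub, hx, hy]
  comp_id {X Y} f := by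
    induction f using GroupCompletion.induction with
    | hof a =>
      rw [GroupCompletion.lift₂_of]
      exact congrArg GrothendieckAddGroup.of (SpanClass.comp_id a)
    | hsub x y hx hy => rw [map_sub, AddMonoidHom.sub_apply, hx, hy]
  assoc {W X Y Z} f g h := by
    induction f using GroupCompletion.induction with
    | hof a =>
      induction g using GroupCompletion.induction with
      | hof b =>
        induction h using GroupCompletion.induction with
        | hof c =>
          simp only [GroupCompletion.lift₂_of]
          exact congrArg GrothendieckAddGroup.of (SpanClass.comp_assoc a b c)
        | hsub x y hx hy => simp only [map_sub, hx, hy]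
      | hsub x y hx hy => simp only [map_sub, AddMonoidHom.sub_apply, hx, hy]
    | hsub x y hx hy => simp only [map_sub, AddMonoidHom.sub_apply, hx, hy]

noncomputable instance : Preadditive (BurnsideCat G) where
  homGroup X Y := inferInstanceAs
    (AddCommGroup (GrothendieckAddGroup (SpanClass X.toFinGSet Y.toFinGSet)))
  add_comp X Y Z f f' g :=
    DFunLike.congr_fun ((GroupCompletion.lift₂ (SpanClass.compHom (X := X.toFinGSet)
      (Y := Y.toFinGSet) (Z := Z.toFinGSet))).map_add' f f') g
  comp_add X Y Z f g g' :=
    (GroupCompletion.lift₂ (SpanClass.compHom (X := X.toFinGSet)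
      (Y := Y.toFinGSet) (Z := Z.toFinGSet)) f).map_add' g g'

/-- The morphism of the Burnside category represented by a span. -/
noncomputable def ofSpan {X Y : FinGSet G} (s : GSpan X Y) : of X ⟶ of Y :=
  GrothendieckAddGroup.of (SpanClass.mk s)

end BurnsideCat

/-- A `G`-Mackey functor: an additive functor from the Burnside category to abelian groups. -/
abbrev MackeyFunctor (G : Type u) [Group G] := BurnsideCat G ⥤+ AddCommGrpCat.{u + 1}

/-! ### The action of spans on singular manifolds -/

namespace SingularGManifold

variable {G : Type u} [Group G] {n : ℕ} {X Y U : FinGSet G}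

/-- The underlying space `{(m, u) ∈ M × U | f(m) = α(u)}` of the pullback of `(M, f)` along `α`. -/
abbrev PullbackSpace (A : SingularGManifold G n X) (α : U →[G] X) : Type u :=
  {p : A × U // A.f p.1 = α p.2}

namespace PullbackSpace

variable (A : SingularGManifold G n X) (α : U →[G] X)

instance : MulAction G (A.PullbackSpace α) where
  smul g p := ⟨(g • p.1.1, g • p.1.2), by rw [A.f_smul, map_smul, p.2]⟩
  one_smul p := Subtype.ext (Prod.ext (one_smul G p.1.1) (one_smul G p.1.2))
  mul_smul g h p := Subtype.ext (Prod.ext (mul_smul g h p.1.1) (mul_smul g h p.1.2))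

/-- The projection to `M`. -/
def proj (p : A.PullbackSpace α) : A := p.1.1

lemma isLocalHomeomorph_proj : IsLocalHomeomorph (proj A α) := by
  rw [isLocalHomeomorph_iff_isOpenEmbedding_restrict]
  intro p
  have hs : IsOpen {q : A.PullbackSpace α | q.1.2 = p.1.2} :=
    (isOpen_discrete {p.1.2}).preimage (continuous_snd.comp continuous_subtype_val)
  refine ⟨_, hs.mem_nhds rfl, ?_⟩
  have hT : IsOpen {m : A | A.f m = α p.1.2} :=
    (isOpen_discrete {α p.1.2}).preimage A.continuous_f
  let e : {q : A.PullbackSpace α | q.1.2 = p.1.2} ≃ₜ {m : A | A.f m = α p.1.2} :=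
    { toFun := fun q => ⟨q.1.1.1, by
        have h₁ := q.1.2
        have h₂ : q.1.1.2 = p.1.2 := q.2
        rw [h₂] at h₁
        exact h₁⟩
      invFun := fun m => ⟨⟨(m.1, p.1.2), m.2⟩, rfl⟩
      left_inv := by
        rintro ⟨⟨⟨m, u⟩, h⟩, h'⟩
        have h'' : u = p.1.2 := h'
        subst h''
        rfl
      right_inv := fun _ => rfl
      continuous_toFun := by fun_prop
      continuous_invFun := by fun_prop }
  exact hT.isOpenEmbedding_subtypeVal.comp e.isOpenEmbedding

instance : CompactSpace (A.PullbackSpace α) := by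
  have : IsClosed {p : A × U | A.f p.1 = α p.2} :=
    isClosed_eq (A.continuous_f.comp continuous_fst)
      (continuous_of_discreteTopology.comp continuous_snd)
  exact isCompact_iff_compactSpace.1 this.isCompact

noncomputable instance : ChartedSpace (BoundaryModelSpace n) (A.PullbackSpace α) :=
  LocalHomeoPullback.chartedSpace (isLocalHomeomorph_proj A α)

end PullbackSpace

open PullbackSpace in
/-- The pullback `(M̃, f̃)` of the singular manifold `(M, f)` in `X` along a map `α : U → X` of
finite `G`-sets. The smooth structure is the one for which the projection `M̃ → M` is a local
diffeomorphism, and `f̃` is the projection to `U`. -/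
noncomputable def pullback (A : SingularGManifold G n X) (α : U →[G] X) :
    SingularGManifold G n U where
  carrier := A.PullbackSpace α
  isManifold := LocalHomeoPullback.isManifold (isLocalHomeomorph_proj A α) _ _
  contMDiff_smul g := by
    refine LocalHomeoPullback.contMDiff_of_proj (isLocalHomeomorph_proj A α) _ _ ?_ ?_
    · have h : Continuous fun m : A => g • m := (A.contMDiff_smul g).continuous
      exact Continuous.subtype_mk (((h.comp continuous_fst).prodMk
        ((continuous_of_discreteTopology (f := fun u : U => g • u)).comp continuous_snd)).comp
        continuous_subtype_val) _
    · exact (A.contMDiff_smul g).comp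
        (LocalHomeoPullback.contMDiff_proj (isLocalHomeomorph_proj A α) _ _)
  f p := p.1.2
  continuous_f := continuous_snd.comp continuous_subtype_val
  f_smul _ _ := rfl

/-- The pushforward `(M, β ∘ f)` of a singular manifold `(M, f)` in `U`. -/
def pushforward (A : SingularGManifold G n U) (β : U →[G] Y) : SingularGManifold G n Y where
  toGManifold := A.toGManifold
  f := β ∘ A.f
  continuous_f := continuous_of_discreteTopology.comp A.continuous_f
  f_smul g m := by
    simp only [Function.comp_apply]
    rw [A.f_smul, map_smul]

/-- The action of a span `X ← U → Y`: pull back along `α : U → X` and push forward along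
`β : U → Y`, that is `(M, f) ↦ (M̃, β ∘ f̃)`. -/
noncomputable def applySpan (s : GSpan X Y) (A : SingularGManifold G n X) :
    SingularGManifold G n Y :=
  (A.pullback s.left).pushforward s.right

/-- The fibre `f⁻¹(eH)` of a singular manifold `(M, f)` in `G/H`, as an open submanifold of `M`. -/
def fibreOpens [Finite G] {H : Subgroup G} (A : SingularGManifold G n (FinGSet.orbit H)) :
    TopologicalSpace.Opens A :=
  ⟨A.f ⁻¹' {FinGSet.orbitBase H}, (isOpen_discrete _).preimage A.continuous_f⟩

/-- The subgroup `H` acts on the fibre `f⁻¹(eH)` by restriction of the action of `G`. -/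
instance [Finite G] {H : Subgroup G} (A : SingularGManifold G n (FinGSet.orbit H)) :
    MulAction H A.fibreOpens where
  smul h m := ⟨(h : G) • m.1, by
    have hm : A.f m.1 = FinGSet.orbitBase H := m.2
    have hh : (h : G) • FinGSet.orbitBase H = FinGSet.orbitBase H := by
      change (((h : G) * 1 : G) : G ⧸ H) = ((1 : G) : G ⧸ H)
      rw [mul_one, QuotientGroup.eq]
      simp
    change A.f ((h : G) • m.1) = FinGSet.orbitBase H
    rw [A.f_smul, hm, hh]⟩
  one_smul m := Subtype.ext (one_smul G m.1)
  mul_smul h k m := Subtype.ext (mul_smul (h : G) (k : G) m.1)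

/-- The fibre `f⁻¹(eH)` of a singular manifold `(M, f)` in `G/H`, as a compact `H`-manifold (that
is, as a singular `H`-manifold in the point). -/
noncomputable def fibre [Finite G] {H : Subgroup G}
    (A : SingularGManifold G n (FinGSet.orbit H)) : SingularGManifold H n PUnit.{u + 1} where
  carrier := A.fibreOpens
  compactSpace := by
    have : IsClosed (A.f ⁻¹' {FinGSet.orbitBase H}) :=
      (isClosed_discrete _).preimage A.continuous_f
    exact isCompact_iff_compactSpace.1 this.isCompact
  contMDiff_smul h := by
    rw [← ContMDiff.subtypeVal_comp_iff]
    exact (A.contMDiff_smul (h : G)).comp contMDiff_subtype_val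
  f _ := PUnit.unit
  continuous_f := continuous_const
  f_smul _ _ := rfl

end SingularGManifold

/-!
The groups `SK^G(X)` are functorial in spans because every construction involved is a pullback
along a map that looks like the identity in charts. For finite `G`-sets, the projection `M̃ → M`
of a pullback is a finite covering of an open and closed part of `M`; the fibre `f⁻¹(eH)` is open
and closed in `M`; and `G ×_H N`, once a section `σ` of `G → G/H` is chosen, is the product `G/H ×
N`, which projects to `N`. The predicate `IsChartPreserving` covers these three maps. From it one
gets at once that the map is smooth, has bijective differential, reflects smoothness of continuous
maps into its source, and pulls back the boundary to the boundary.

The heart of the proof is `GManifold.IsPasting.lift`: the pullback of a pasting `A = M₁ ∪ M₂`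
along chart-preserving maps forming cartesian squares is again a pasting. The group is allowed to
change, and the chart-preserving maps need not be equivariant, so that it applies to pullbacks
along `α`, to fibres and to induction alike. An SK-operation in `X` only identifies the maps to
`X` on the pieces up to homotopy, but a homotopy in a discrete space is constant, so the two maps
agree on the pieces (`GHomotopic.eq`), which can therefore be pulled back as singular manifolds in
`X`.

With the universal property `SK.lift`, the action `SK.spanMap` of a span is thereby well defined.
Its compatibility with identities, composition and sums of spans comes from explicit
diffeomorphisms between iterated pullbacks, each of them a continuous bijection commuting with the
projections to `M` (`SingularGManifold.Rel.of_comp_eq`); this gives the Mackey functor. The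
isomorphism `SK^G(G/H) ≅ SK^H` has the inverse `[N] ↦ [G ×_H N]`: the fibre of `G ×_H N` over `eH`
is `N` (`fibre_induce_rel`), and `[g, m] ↦ g m` is a diffeomorphism `G ×_H f⁻¹(eH) → M`
(`induce_fibre_rel`).
-/

/-! ### Maps that preserve the preferred charts -/

/-- A continuous map `p : N → M` preserves the preferred charts if near each point `x` the preferred
extended chart of `N` at `x` is `p` followed by the preferred extended chart of `M` at `p x`. Such a
map is a local diffeomorphism; the stronger condition makes the statements on smoothness,
differentials and boundaries below immediate. -/
structure IsChartPreserving {E H M N : Type*} [NormedAddCommGroup E] [NormedSpace ℝ E]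
    [TopologicalSpace H] (I : ModelWithCorners ℝ E H) [TopologicalSpace M] [ChartedSpace H M]
    [TopologicalSpace N] [ChartedSpace H N] (p : N → M) : Prop where
  continuous : Continuous p
  eventuallyEq : ∀ x : N, extChartAt I x =ᶠ[𝓝 x] extChartAt I (p x) ∘ p

namespace IsChartPreserving

variable {E H M N P : Type*} [NormedAddCommGroup E] [NormedSpace ℝ E]
  [TopologicalSpace H] {I : ModelWithCorners ℝ E H} [TopologicalSpace M] [ChartedSpace H M]
  [TopologicalSpace N] [ChartedSpace H N] [TopologicalSpace P] [ChartedSpace H P]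

lemma id : IsChartPreserving I (id : M → M) := ⟨continuous_id, fun _ => .rfl⟩

lemma comp {p : N → M} {q : P → N} (hp : IsChartPreserving I p) (hq : IsChartPreserving I q) :
    IsChartPreserving I (p ∘ q) where
  continuous := hp.continuous.comp hq.continuous
  eventuallyEq x := (hq.eventuallyEq x).trans
    ((hp.eventuallyEq (q x)).comp_tendsto hq.continuous.continuousAt)

lemma inl : IsChartPreserving I (Sum.inl : M → M ⊕ N) where
  continuous := continuous_inl
  eventuallyEq x := .of_forall fun y => by simp [extChartAt]

lemma inr : IsChartPreserving I (Sum.inr : N → M ⊕ N) where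
  continuous := continuous_inr
  eventuallyEq x := .of_forall fun y => by simp [extChartAt]

lemma sumElim {p : N → M} {q : P → M} (hp : IsChartPreserving I p) (hq : IsChartPreserving I q) :
    IsChartPreserving I (Sum.elim p q) where
  continuous := hp.continuous.sumElim hq.continuous
  eventuallyEq := by
    rintro (x | x)
    · rw [Filter.EventuallyEq, ← IsOpenEmbedding.inl.map_nhds_eq, Filter.eventually_map]
      exact (inl.eventuallyEq x).symm.trans (hp.eventuallyEq x)
    · rw [Filter.EventuallyEq, ← IsOpenEmbedding.inr.map_nhds_eq, Filter.eventually_map]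
      exact (inr.eventuallyEq x).symm.trans (hq.eventuallyEq x)

lemma opensVal (U : TopologicalSpace.Opens M) : IsChartPreserving I (Subtype.val : U → M) where
  continuous := continuous_subtype_val
  eventuallyEq _ := .of_forall fun _ => rfl

lemma of_isLocalHomeomorph {X : Type*} [TopologicalSpace X] {p : X → M}
    (hp : IsLocalHomeomorph p) (I : ModelWithCorners ℝ E H) :
    let _ := LocalHomeoPullback.chartedSpace (H := H) hp
    IsChartPreserving I p :=
  let _ := LocalHomeoPullback.chartedSpace (H := H) hp
  { continuous := hp.continuous
    eventuallyEq := fun x => .of_forall fun y => LocalHomeoPullback.extChartAt_eq hp I x y }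

variable {k : WithTop ℕ∞} {p : N → M} {E' H' Q : Type*} [NormedAddCommGroup E']
  [NormedSpace ℝ E'] [TopologicalSpace H'] {J : ModelWithCorners ℝ E' H'} [TopologicalSpace Q]
  [ChartedSpace H' Q]

lemma contMDiff [IsManifold I k N] (hp : IsChartPreserving I p) : ContMDiff I I k p := by
  intro x
  rw [contMDiffAt_iff_target]
  exact ⟨hp.continuous.continuousAt,
    contMDiffAt_extChartAt.congr_of_eventuallyEq (hp.eventuallyEq x).symm⟩

lemma contMDiff_of_comp (hp : IsChartPreserving I p) {φ : Q → N} (hφ : Continuous φ)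
    (h : ContMDiff J I k (p ∘ φ)) : ContMDiff J I k φ := by
  intro x
  rw [contMDiffAt_iff_target]
  exact ⟨hφ.continuousAt, (contMDiffAt_iff_target.1 (h x)).2.congr_of_eventuallyEq
    ((hp.eventuallyEq (φ x)).comp_tendsto hφ.continuousAt)⟩

lemma preimage_boundary (hp : IsChartPreserving I p) : p ⁻¹' I.boundary M = I.boundary N := by
  ext x
  change extChartAt I (p x) (p x) ∈ frontier (Set.range I) ↔
    extChartAt I x x ∈ frontier (Set.range I)
  rw [(hp.eventuallyEq x).eq_of_nhds]
  rfl

/-- In the preferred charts, a map that preserves them is the identity. -/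
lemma mfderiv_eq [IsManifold I 1 N] (hp : IsChartPreserving I p) (x : N) :
    mfderiv I I p x = ContinuousLinearMap.id ℝ E := by
  rw [((hp.contMDiff (k := 1)).mdifferentiable one_ne_zero x).mfderiv]
  have h : writtenInExtChartAt I I x p =ᶠ[𝓝[Set.range I] (extChartAt I x x)] _root_.id := by
    have h₁ : Filter.Tendsto (extChartAt I x).symm (𝓝[Set.range I] (extChartAt I x x)) (𝓝 x) := by
      have := continuousAt_extChartAt_symm (I := I) x
      rw [ContinuousAt, extChartAt_to_inv] at this
      exact this.mono_left nhdsWithin_le_nhds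
    filter_upwards [h₁.eventually (hp.eventuallyEq x), extChartAt_target_mem_nhdsWithin (I := I) x]
      with y hy hy'
    exact hy.symm.trans ((extChartAt I x).right_inv hy')
  rw [h.fderivWithin_eq (h.eq_of_nhdsWithin ⟨_, rfl⟩)]
  exact fderivWithin_id (I.uniqueDiffOn _ ⟨_, rfl⟩)

end IsChartPreserving

/-! ### Lifting pastings and diffeomorphisms along chart-preserving maps -/

namespace GManifold

variable {G G' : Type u} [Group G] [Group G'] {n : ℕ}

/-- A map covering an equivariant embedding along chart-preserving maps is an embedding as soon as
it is continuous, injective and equivariant; the groups upstairs and downstairs may differ. -/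
lemma IsGEmbedding.lift {M A : GManifold G n} {M' A' : GManifold G' n} {i : M → A}
    (hi : IsGEmbedding i) {p : M' → M} {q : A' → A} (hp : IsChartPreserving (boundaryModel n) p)
    (hq : IsChartPreserving (boundaryModel n) q) {i' : M' → A'} (hc : Continuous i')
    (hinj : Function.Injective i') (hsmul : ∀ (g : G') (m : M'), i' (g • m) = g • i' m)
    (hcomm : ∀ m, q (i' m) = i (p m)) : IsGEmbedding i' := by
  have hqi : q ∘ i' = i ∘ p := funext hcomm
  have hs : ContMDiff (boundaryModel n) (boundaryModel n) ∞ i' :=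
    hq.contMDiff_of_comp hc (by rw [hqi]; exact hi.contMDiff.comp hp.contMDiff)
  refine ⟨(hc.isClosedEmbedding hinj).isEmbedding, hs, fun x => ?_, hsmul⟩
  have h0 : (∞ : WithTop ℕ∞) ≠ 0 := by simp
  have h1 : IsManifold (boundaryModel n) 1 A' := .of_le (n := ∞) (by simp)
  have h2 : IsManifold (boundaryModel n) 1 M' := .of_le (n := ∞) (by simp)
  have e₁ := mfderiv_comp x (hq.contMDiff (k := ∞) |>.mdifferentiable h0 _)
    (hs.mdifferentiable h0 x)
  have e₂ := mfderiv_comp x (hi.contMDiff.mdifferentiable h0 _)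
    (hp.contMDiff (k := ∞) |>.mdifferentiable h0 x)
  rw [hqi, e₂, hq.mfderiv_eq, hp.mfderiv_eq] at e₁
  have e₃ := hi.injective_mfderiv (p x)
  intro v w hvw
  apply e₃
  exact (DFunLike.congr_fun e₁ v).trans (hvw.trans (DFunLike.congr_fun e₁ w).symm)

lemma IsBoundaryPart.preimage {M : GManifold G n} {M' : GManifold G' n} {S : Set M}
    (hS : M.IsBoundaryPart S) {p : M' → M} (hp : IsChartPreserving (boundaryModel n) p) :
    M'.IsBoundaryPart (p ⁻¹' S) where
  subset := (Set.preimage_mono hS.subset).trans hp.preimage_boundary.subset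
  isClosed := hS.isClosed.preimage hp.continuous
  isOpen := by
    obtain ⟨U, hU, h⟩ := hS.isOpen
    refine ⟨p ⁻¹' U, hU.preimage hp.continuous, ?_⟩
    rw [h, Set.preimage_inter]
    exact congrArg (· ∩ _) hp.preimage_boundary

/-- If the pieces of a pasting `A = M₁ ∪ M₂` are pulled back along a chart-preserving map
`A' → A` (the hypotheses `hlift₁` and `hlift₂` say that the two squares are cartesian), they form a
pasting of `A'`. -/
lemma IsPasting.lift {A M₁ M₂ : GManifold G n} {A' M₁' M₂' : GManifold G' n} {S₁ : Set M₁}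
    {S₂ : Set M₂} {i₁ : M₁ → A} {i₂ : M₂ → A} (h : A.IsPasting M₁ M₂ S₁ S₂ i₁ i₂)
    {q : A' → A} {p₁ : M₁' → M₁} {p₂ : M₂' → M₂} (hq : IsChartPreserving (boundaryModel n) q)
    (hp₁ : IsChartPreserving (boundaryModel n) p₁) (hp₂ : IsChartPreserving (boundaryModel n) p₂)
    {i₁' : M₁' → A'} {i₂' : M₂' → A'} (hc₁ : Continuous i₁') (hc₂ : Continuous i₂')
    (hinj₁ : Function.Injective i₁') (hinj₂ : Function.Injective i₂')
    (hsmul₁ : ∀ (g : G') m, i₁' (g • m) = g • i₁' m)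
    (hsmul₂ : ∀ (g : G') m, i₂' (g • m) = g • i₂' m)
    (hcomm₁ : ∀ m, q (i₁' m) = i₁ (p₁ m)) (hcomm₂ : ∀ m, q (i₂' m) = i₂ (p₂ m))
    (hlift₁ : ∀ a m, q a = i₁ m → ∃ m', i₁' m' = a ∧ p₁ m' = m)
    (hlift₂ : ∀ a m, q a = i₂ m → ∃ m', i₂' m' = a ∧ p₂ m' = m) :
    A'.IsPasting M₁' M₂' (p₁ ⁻¹' S₁) (p₂ ⁻¹' S₂) i₁' i₂' := by
  have r₁ : Set.range i₁' = q ⁻¹' Set.range i₁ := by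
    ext a
    constructor
    · rintro ⟨m, rfl⟩
      exact ⟨p₁ m, (hcomm₁ m).symm⟩
    · rintro ⟨m, hm⟩
      obtain ⟨m', h', -⟩ := hlift₁ a m hm.symm
      exact ⟨m', h'⟩
  have r₂ : Set.range i₂' = q ⁻¹' Set.range i₂ := by
    ext a
    constructor
    · rintro ⟨m, rfl⟩
      exact ⟨p₂ m, (hcomm₂ m).symm⟩
    · rintro ⟨m, hm⟩
      obtain ⟨m', h', -⟩ := hlift₂ a m hm.symm
      exact ⟨m', h'⟩
  have s₁ : i₁' '' (p₁ ⁻¹' S₁) = q ⁻¹' (i₁ '' S₁) := by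
    ext a
    constructor
    · rintro ⟨m, hm, rfl⟩
      exact ⟨p₁ m, hm, (hcomm₁ m).symm⟩
    · rintro ⟨m, hm, hma⟩
      obtain ⟨m', h', rfl⟩ := hlift₁ a m hma.symm
      exact ⟨m', hm, h'⟩
  have s₂ : i₂' '' (p₂ ⁻¹' S₂) = q ⁻¹' (i₂ '' S₂) := by
    ext a
    constructor
    · rintro ⟨m, hm, rfl⟩
      exact ⟨p₂ m, hm, (hcomm₂ m).symm⟩
    · rintro ⟨m, hm, hma⟩
      obtain ⟨m', h', rfl⟩ := hlift₂ a m hma.symm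
      exact ⟨m', hm, h'⟩
  exact
    { isBoundaryPart₁ := h.isBoundaryPart₁.preimage hp₁
      isBoundaryPart₂ := h.isBoundaryPart₂.preimage hp₂
      isGEmbedding₁ := h.isGEmbedding₁.lift hp₁ hq hc₁ hinj₁ hsmul₁ hcomm₁
      isGEmbedding₂ := h.isGEmbedding₂.lift hp₂ hq hc₂ hinj₂ hsmul₂ hcomm₂
      union_range := by rw [r₁, r₂, ← Set.preimage_union, h.union_range, Set.preimage_univ]
      inter_range := by rw [r₁, r₂, s₁, ← Set.preimage_inter, h.inter_range]
      image_eq := by rw [s₁, s₂, h.image_eq]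
      disjoint_boundary := by
        rw [s₁]
        exact (h.disjoint_boundary.preimage q).mono_right hq.preimage_boundary.symm.subset }

end GManifold

namespace SingularGManifold

variable {G : Type u} [Group G] {n : ℕ} {X : Type u} [TopologicalSpace X] [MulAction G X]

/-- A continuous equivariant bijection over `X` is a diffeomorphism if it and its inverse are smooth
after composition with chart-preserving maps; its inverse is continuous by compactness. -/
lemma Rel.of_isChartPreserving {A B : SingularGManifold G n X} {M N : Type*} [TopologicalSpace M]
    [ChartedSpace (BoundaryModelSpace n) M] [TopologicalSpace N]
    [ChartedSpace (BoundaryModelSpace n) N] {p : A → M} {q : B → N}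
    (hp : IsChartPreserving (boundaryModel n) p) (hq : IsChartPreserving (boundaryModel n) q)
    (φ : A ≃ B) (hφ : Continuous φ)
    (hs : ContMDiff (boundaryModel n) (boundaryModel n) ∞ (q ∘ φ))
    (hs' : ContMDiff (boundaryModel n) (boundaryModel n) ∞ (p ∘ φ.symm))
    (hsmul : ∀ (g : G) (m : A), φ (g • m) = g • φ m) (hf : ∀ m, B.f (φ m) = A.f m) : Rel A B :=
  ⟨⟨⟨φ, hq.contMDiff_of_comp hφ hs, hp.contMDiff_of_comp
    (hφ.homeoOfEquivCompactToT2 (f := φ)).symm.continuous hs'⟩, hsmul⟩, hf⟩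

/-- A continuous equivariant bijection over `X` between manifolds with chart-preserving maps to `M`
is a diffeomorphism if it commutes with these maps. -/
lemma Rel.of_comp_eq {A B : SingularGManifold G n X} {M : Type*} [TopologicalSpace M]
    [ChartedSpace (BoundaryModelSpace n) M] {p : A → M} {q : B → M}
    (hp : IsChartPreserving (boundaryModel n) p) (hq : IsChartPreserving (boundaryModel n) q)
    (φ : A ≃ B) (hφ : Continuous φ) (hcomm : ∀ m, q (φ m) = p m)
    (hsmul : ∀ (g : G) (m : A), φ (g • m) = g • φ m) (hf : ∀ m, B.f (φ m) = A.f m) : Rel A B :=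
  .of_isChartPreserving hp hq φ hφ (by rw [show q ∘ φ = p from funext hcomm]; exact hp.contMDiff)
    (by
      rw [show p ∘ φ.symm = q from funext fun m => by simp [← hcomm]]
      exact hq.contMDiff) hsmul hf

end SingularGManifold

/-! ### The universal property of `SK^G(X)` -/

namespace SingularMonoid

variable {G : Type u} [Group G] {n : ℕ} {X : Type u} [TopologicalSpace X] [MulAction G X]
  {C : Type*} [AddCommGroup C]

/-- The homomorphism on `𝓜^G(X)` given by an additive diffeomorphism invariant. -/
def lift (F : SingularGManifold G n X → C) (hrel : ∀ A B, A.Rel B → F A = F B)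
    (hsum : ∀ A B, F (A.sum B) = F A + F B) : SingularMonoid G n X →+ C :=
  have hadd (a b : SingularMonoid G n X) : Quotient.lift F hrel (a + b) =
      Quotient.lift F hrel a + Quotient.lift F hrel b := by
    obtain ⟨A⟩ := a
    obtain ⟨B⟩ := b
    exact hsum A B
  { toFun := Quotient.lift F hrel
    map_zero' := by simpa using hadd 0 0
    map_add' := hadd }

end SingularMonoid

namespace SK

open Algebra

variable {G : Type u} [Group G] {n : ℕ} {X : Type u} [TopologicalSpace X] [MulAction G X]
  {C : Type*} [AddCommGroup C]

/-- The homomorphism on `SK^G(X)` given by an additive diffeomorphism invariant that does not change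
under SK-operations. -/
noncomputable def lift (F : SingularGManifold G n X → C) (hrel : ∀ A B, A.Rel B → F A = F B)
    (hsum : ∀ A B, F (A.sum B) = F A + F B) (hop : ∀ A B, A.SKOperation B → F A = F B) :
    SK G n X →+ C :=
  QuotientAddGroup.lift (skRelations G n X)
    (GrothendieckAddGroup.lift (SingularMonoid.lift F hrel hsum)) <| by
    rw [skRelations, AddSubgroup.closure_le]
    rintro _ ⟨A, B, h, rfl⟩
    have h' : F A = F B := by
      induction h with
      | refl => rfl
      | tail _ h ih => exact ih.trans (hop _ _ h)
    rw [SetLike.mem_coe, AddMonoidHom.mem_ker, map_sub, GroupCompletion.lift_of,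
      GroupCompletion.lift_of]
    exact sub_eq_zero_of_eq h'

lemma lift_mk (F : SingularGManifold G n X → C) (hrel : ∀ A B, A.Rel B → F A = F B)
    (hsum : ∀ A B, F (A.sum B) = F A + F B) (hop : ∀ A B, A.SKOperation B → F A = F B)
    (A : SingularGManifold G n X) : lift F hrel hsum hop (mk A) = F A :=
  GroupCompletion.lift_of _ _

lemma hom_ext {a b : SK G n X →+ C} (h : ∀ A, a (mk A) = b (mk A)) : a = b := by
  ext x
  obtain ⟨x, rfl⟩ := QuotientAddGroup.mk_surjective x
  induction x using GroupCompletion.induction with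
  | hof m =>
    obtain ⟨A⟩ := m
    exact h A
  | hsub x y hx hy => 
    exact (map_sub a (QuotientAddGroup.mk x) (QuotientAddGroup.mk y)).trans
      ((congrArg₂ _ hx hy).trans (map_sub b (QuotientAddGroup.mk x) (QuotientAddGroup.mk y)).symm)

lemma mk_eq_of_rel {A B : SingularGManifold G n X} (h : A.Rel B) : mk A = mk B :=
  congrArg (fun m => QuotientAddGroup.mk (GrothendieckAddGroup.of m)) (Quotient.sound h)

lemma mk_eq_of_skOperation {A B : SingularGManifold G n X} (h : A.SKOperation B) :
    mk A = mk B := by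
  exact QuotientAddGroup.eq_iff_sub_mem.2 (AddSubgroup.subset_closure ⟨A, B, .single h, rfl⟩)

lemma mk_sum (A B : SingularGManifold G n X) : mk (A.sum B) = mk A + mk B := by
  have : (SingularMonoid.mk (A.sum B)) = SingularMonoid.mk A + SingularMonoid.mk B := rfl
  rw [mk, this, map_add, QuotientAddGroup.mk_add]
  rfl

end SK

/-! ### Homotopies into discrete spaces -/

namespace GHomotopic

variable {G M X : Type*} [TopologicalSpace M] [TopologicalSpace X] [SMul G M] [SMul G X]

lemma refl {f : M → X} (hf : Continuous f) (hsmul : ∀ (g : G) (m : M), f (g • m) = g • f m) :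
    GHomotopic G f f :=
  ⟨fun p => f p.2, hf.comp continuous_snd, fun _ => rfl, fun _ => rfl, fun _ => hsmul⟩

lemma eq [DiscreteTopology X] {f f' : M → X} (h : GHomotopic G f f') : f = f' := by
  obtain ⟨h, hc, h0, h1, -⟩ := h
  funext m
  rw [← h0, ← h1]
  exact PreconnectedSpace.constant inferInstance (f := fun t => h (t, m)) (by fun_prop)

end GHomotopic

/-! ### The action of spans on `SK^G` -/

namespace SingularGManifold

variable {G : Type u} [Group G] {n : ℕ}

/-- The restriction of a singular manifold along an equivariant embedding. -/
def restrict {X : Type u} [TopologicalSpace X] [MulAction G X] (A : SingularGManifold G n X)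
    {M : GManifold G n} {i : M → A} (hi : GManifold.IsGEmbedding (N := A.toGManifold) i) :
    SingularGManifold G n X where
  toGManifold := M
  f := A.f ∘ i
  continuous_f := A.continuous_f.comp hi.isEmbedding.continuous
  f_smul g m := by rw [Function.comp_apply, hi.map_smul, A.f_smul]; rfl

variable {X Y Z U : FinGSet G}

namespace PullbackSpace

lemma isChartPreserving_proj (A : SingularGManifold G n X) (α : U →[G] X) :
    IsChartPreserving (N := A.pullback α) (boundaryModel n) (proj A α) :=
  IsChartPreserving.of_isLocalHomeomorph (isLocalHomeomorph_proj A α) _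

/-- The map of pullbacks along `α` induced by a map over `X`. -/
def map {A B : SingularGManifold G n X} (α : U →[G] X) (i : A → B) (hi : ∀ m, B.f (i m) = A.f m)
    (p : A.pullback α) : B.pullback α :=
  (⟨(i (proj A α p), p.1.2), (hi _).trans p.2⟩ : B.PullbackSpace α)

variable {A B : SingularGManifold G n X} {α : U →[G] X} {i : A → B} {hi : ∀ m, B.f (i m) = A.f m}

lemma continuous_map (h : Continuous i) : Continuous (map α i hi) :=
  ((h.comp (continuous_fst.comp continuous_subtype_val)).prodMk
    (continuous_snd.comp continuous_subtype_val)).subtype_mk _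

lemma map_injective (h : Function.Injective i) : Function.Injective (map α i hi) := by
  intro p q hpq
  exact Subtype.ext (Prod.ext (h (congrArg (proj B α) hpq))
    (congrArg (fun r : B.PullbackSpace α => r.1.2) hpq))

lemma map_smul (h : ∀ (g : G) m, i (g • m) = g • i m) (g : G) (p : A.pullback α) :
    map α i hi (g • p) = g • map α i hi p :=
  Subtype.ext (Prod.ext (h g (proj A α p)) rfl)

lemma map_lift (a : B.pullback α) (m : A) (h : proj B α a = i m) :
    ∃ p, map α i hi p = a ∧ proj A α p = m :=
  ⟨(⟨(m, a.1.2), by rw [← hi, ← h]; exact a.2⟩ : A.PullbackSpace α),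
    Subtype.ext (Prod.ext h.symm rfl), rfl⟩

end PullbackSpace

open PullbackSpace

lemma _root_.GManifold.IsPasting.pullback {A M₁ M₂ : SingularGManifold G n X} {S₁ : Set M₁}
    {S₂ : Set M₂} {i₁ : M₁ → A} {i₂ : M₂ → A} (α : U →[G] X)
    (h : A.toGManifold.IsPasting M₁.toGManifold M₂.toGManifold S₁ S₂ i₁ i₂)
    (h₁ : ∀ m, A.f (i₁ m) = M₁.f m) (h₂ : ∀ m, A.f (i₂ m) = M₂.f m) :
    (A.pullback α).toGManifold.IsPasting (M₁.pullback α).toGManifold (M₂.pullback α).toGManifold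
      (proj M₁ α ⁻¹' S₁) (proj M₂ α ⁻¹' S₂) (map α i₁ h₁) (map α i₂ h₂) :=
  h.lift (isChartPreserving_proj A α) (isChartPreserving_proj M₁ α) (isChartPreserving_proj M₂ α)
    (continuous_map h.isGEmbedding₁.isEmbedding.continuous)
    (continuous_map h.isGEmbedding₂.isEmbedding.continuous)
    (map_injective h.isGEmbedding₁.isEmbedding.injective)
    (map_injective h.isGEmbedding₂.isEmbedding.injective)
    (map_smul h.isGEmbedding₁.map_smul) (map_smul h.isGEmbedding₂.map_smul)
    (fun _ => rfl) (fun _ => rfl) map_lift map_lift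

/-- Spans preserve SK-operations. As `X` is discrete, the two maps to `X` agree on the pieces `M₁`
and `M₂`, so that the pieces can be pulled back as singular manifolds in `X`. -/
lemma SKOperation.applySpan {A B : SingularGManifold G n X} (h : A.SKOperation B)
    (s : GSpan X Y) : (A.applySpan s).SKOperation (B.applySpan s) := by
  obtain ⟨M₁, M₂, S₁, S₂, i₁, i₂, j₁, j₂, hi, hj, h₁, h₂⟩ := h
  have h₁ := h₁.eq
  have h₂ := h₂.eq
  refine ⟨((A.restrict hi.isGEmbedding₁).pullback s.left).toGManifold,
    ((A.restrict hi.isGEmbedding₂).pullback s.left).toGManifold, _, _,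
    _, _, _, _, hi.pullback (M₁ := A.restrict hi.isGEmbedding₁)
      (M₂ := A.restrict hi.isGEmbedding₂) s.left (fun _ => rfl) (fun _ => rfl),
    hj.pullback (M₁ := A.restrict hi.isGEmbedding₁)
      (M₂ := A.restrict hi.isGEmbedding₂) s.left (fun m => (congrFun h₁ m).symm)
      (fun m => (congrFun h₂ m).symm), ?_, ?_⟩
  · exact .refl (((A.restrict hi.isGEmbedding₁).pullback s.left).pushforward s.right).continuous_f
      (((A.restrict hi.isGEmbedding₁).pullback s.left).pushforward s.right).f_smul
  · exact .refl (((A.restrict hi.isGEmbedding₂).pullback s.left).pushforward s.right).continuous_f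
      (((A.restrict hi.isGEmbedding₂).pullback s.left).pushforward s.right).f_smul

lemma Rel.applySpan {A B : SingularGManifold G n X} (h : A.Rel B) (s : GSpan X Y) :
    (A.applySpan s).Rel (B.applySpan s) := by
  obtain ⟨φ, hφ⟩ := h
  have hφ' (m) : A.f (φ.toDiffeo.symm m) = B.f m := by rw [← hφ, φ.toDiffeo.apply_symm_apply]
  refine .of_isChartPreserving (isChartPreserving_proj A s.left) (isChartPreserving_proj B s.left)
    ⟨map s.left φ.toDiffeo hφ, map s.left φ.toDiffeo.symm hφ', fun p => ?_, fun p => ?_⟩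
    (continuous_map (hi := hφ) φ.toDiffeo.continuous)
    (φ.toDiffeo.contMDiff.comp (isChartPreserving_proj A s.left).contMDiff)
    (φ.toDiffeo.symm.contMDiff.comp (isChartPreserving_proj B s.left).contMDiff)
    (map_smul (hi := hφ) φ.map_smul) (fun _ => rfl)
  · exact Subtype.ext (Prod.ext (φ.toDiffeo.symm_apply_apply _) rfl)
  · exact Subtype.ext (Prod.ext (φ.toDiffeo.apply_symm_apply _) rfl)

lemma sum_applySpan_rel (A B : SingularGManifold G n X) (s : GSpan X Y) :
    ((A.applySpan s).sum (B.applySpan s)).Rel ((A.sum B).applySpan s) := by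
  refine .of_comp_eq ((IsChartPreserving.inl.comp (isChartPreserving_proj A s.left)).sumElim
    (IsChartPreserving.inr.comp (isChartPreserving_proj B s.left)))
    (isChartPreserving_proj (A.sum B) s.left)
    ⟨Sum.elim (map (A := A) (B := A.sum B) s.left Sum.inl fun _ => rfl)
      (map (A := B) (B := A.sum B) s.left Sum.inr fun _ => rfl),
      fun p => match p with
        | ⟨(Sum.inl m, u), h⟩ => Sum.inl (⟨(m, u), h⟩ : A.PullbackSpace s.left)
        | ⟨(Sum.inr m, u), h⟩ => Sum.inr (⟨(m, u), h⟩ : B.PullbackSpace s.left), ?_, ?_⟩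
    ((continuous_map continuous_inl).sumElim (continuous_map continuous_inr)) ?_ ?_ ?_
  · rintro (_ | _) <;> rfl
  · rintro ⟨⟨m | m, u⟩, h⟩ <;> rfl
  · rintro (_ | _) <;> rfl
  · rintro g (_ | _) <;> rfl
  · rintro (_ | _) <;> rfl

lemma applySpan_rel_of_rel (A : SingularGManifold G n X) {s t : GSpan X Y} (h : s.Rel t) :
    (A.applySpan s).Rel (A.applySpan t) := by
  obtain ⟨e, he, hl, hr⟩ := h
  refine .of_comp_eq (isChartPreserving_proj A s.left) (isChartPreserving_proj A t.left)
    ⟨fun p => (⟨(p.1.1, e p.1.2), p.2.trans (hl _).symm⟩ : A.PullbackSpace t.left),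
      fun p => (⟨(p.1.1, e.symm p.1.2), p.2.trans (by rw [← hl, e.apply_symm_apply])⟩ :
        A.PullbackSpace s.left),
      fun p => Subtype.ext (Prod.ext rfl (e.symm_apply_apply _)),
      fun p => Subtype.ext (Prod.ext rfl (e.apply_symm_apply _))⟩
    ?_ (fun _ => rfl) (fun g p => Subtype.ext (Prod.ext rfl (he g p.1.2))) (fun p => hr p.1.2)
  exact ((continuous_fst.comp continuous_subtype_val).prodMk (continuous_of_discreteTopology.comp
    (continuous_snd.comp continuous_subtype_val))).subtype_mk _

lemma applySpan_id_rel (A : SingularGManifold G n X) : (A.applySpan (GSpan.id X)).Rel A :=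
  .of_comp_eq (isChartPreserving_proj A (MulActionHom.id G)) IsChartPreserving.id
    ⟨proj A (MulActionHom.id G),
      fun m => (⟨(m, A.f m), rfl⟩ : A.PullbackSpace (MulActionHom.id G)),
      fun p => Subtype.ext (Prod.ext rfl p.2), fun _ => rfl⟩
    (continuous_fst.comp continuous_subtype_val) (fun _ => rfl) (fun _ _ => rfl) (fun p => p.2)

lemma applySpan_comp_rel (A : SingularGManifold G n X) (s : GSpan X Y) (t : GSpan Y Z) :
    (A.applySpan (s.comp t)).Rel ((A.applySpan s).applySpan t) := by
  refine .of_comp_eq (isChartPreserving_proj A (s.comp t).left)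
    ((isChartPreserving_proj A s.left).comp (isChartPreserving_proj (A.applySpan s) t.left))
    ⟨fun p => (⟨((⟨(p.1.1, p.1.2.1.1), p.2⟩ : A.PullbackSpace s.left), p.1.2.1.2), p.1.2.2⟩ :
        (A.applySpan s).PullbackSpace t.left),
      fun p => (⟨(p.1.1.1.1, ⟨(p.1.1.1.2, p.1.2), p.2⟩), p.1.1.2⟩ :
        A.PullbackSpace (s.comp t).left), fun _ => rfl, fun _ => rfl⟩
    ?_ (fun _ => rfl) (fun _ _ => rfl) (fun _ => rfl)
  have h : Continuous fun p : A.PullbackSpace (s.comp t).left => p.1.2 :=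
    continuous_snd.comp continuous_subtype_val
  exact ((((continuous_fst.comp continuous_subtype_val).prodMk
    ((continuous_of_discreteTopology (f := fun w : (s.comp t).apex => w.1.1)).comp h)).subtype_mk
      _).prodMk
    ((continuous_of_discreteTopology (f := fun w : (s.comp t).apex => w.1.2)).comp h)).subtype_mk _

lemma applySpan_sum_rel (A : SingularGManifold G n X) (s t : GSpan X Y) :
    ((A.applySpan s).sum (A.applySpan t)).Rel (A.applySpan (s.sum t)) := by
  refine .of_comp_eq ((isChartPreserving_proj A s.left).sumElim (isChartPreserving_proj A t.left))
    (isChartPreserving_proj A (s.sum t).left)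
    ⟨Sum.elim
      (fun p => (⟨(p.1.1, Sum.inl p.1.2), p.2⟩ : A.PullbackSpace (s.sum t).left))
      (fun p => (⟨(p.1.1, Sum.inr p.1.2), p.2⟩ : A.PullbackSpace (s.sum t).left)),
      fun p => match p with
        | ⟨(m, Sum.inl u), h⟩ => Sum.inl (⟨(m, u), h⟩ : A.PullbackSpace s.left)
        | ⟨(m, Sum.inr u), h⟩ => Sum.inr (⟨(m, u), h⟩ : A.PullbackSpace t.left), ?_, ?_⟩
    (.sumElim ?_ ?_) ?_ ?_ ?_
  · rintro (_ | _) <;> rfl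
  · rintro ⟨⟨m, u | u⟩, h⟩ <;> rfl
  · exact ((continuous_fst.comp continuous_subtype_val).prodMk
      ((continuous_of_discreteTopology (β := (s.sum t).apex) (f := Sum.inl)).comp
        (continuous_snd.comp continuous_subtype_val))).subtype_mk _
  · exact ((continuous_fst.comp continuous_subtype_val).prodMk
      ((continuous_of_discreteTopology (β := (s.sum t).apex) (f := Sum.inr)).comp
        (continuous_snd.comp continuous_subtype_val))).subtype_mk _
  · rintro (_ | _) <;> rfl
  · rintro g (_ | _) <;> rfl
  · rintro (_ | _) <;> rfl

end SingularGManifold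

namespace SK

open SingularGManifold Algebra

variable {G : Type u} [Group G] {n : ℕ} {X Y Z : FinGSet G}

/-- The homomorphism `(α, β) : SK^G(X) → SK^G(Y)` given by a span. -/
noncomputable def spanMap (n : ℕ) (s : GSpan X Y) : SK G n X →+ SK G n Y :=
  lift (fun A => mk (A.applySpan s)) (fun _ _ h => mk_eq_of_rel (h.applySpan s))
    (fun A B => by rw [← mk_eq_of_rel (sum_applySpan_rel A B s), mk_sum])
    (fun _ _ h => mk_eq_of_skOperation (h.applySpan s))

@[simp]
lemma spanMap_mk (s : GSpan X Y) (A : SingularGManifold G n X) :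
    spanMap n s (mk A) = mk (A.applySpan s) :=
  lift_mk ..

lemma spanMap_id : spanMap n (GSpan.id X) = AddMonoidHom.id (SK G n X) :=
  hom_ext fun A => by
    rw [spanMap_mk, mk_eq_of_rel A.applySpan_id_rel, AddMonoidHom.id_apply]

lemma spanMap_comp (s : GSpan X Y) (t : GSpan Y Z) :
    spanMap n (s.comp t) = (spanMap n t).comp (spanMap n s) :=
  hom_ext fun A => by
    rw [AddMonoidHom.comp_apply, spanMap_mk, spanMap_mk, spanMap_mk,
      mk_eq_of_rel (A.applySpan_comp_rel s t)]

/-- The additive action of equivalence classes of spans. -/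
noncomputable def spanClassMap (n : ℕ) : SpanClass X Y →+ (SK G n X →+ SK G n Y) :=
  have hrel (s t : GSpan X Y) (h : s.Rel t) : spanMap n s = spanMap n t := hom_ext fun A => by
    rw [spanMap_mk, spanMap_mk, mk_eq_of_rel (A.applySpan_rel_of_rel h)]
  have hadd (a b : SpanClass X Y) : Quotient.lift (spanMap n) hrel (a + b) =
      Quotient.lift (spanMap n) hrel a + Quotient.lift (spanMap n) hrel b := by
    obtain ⟨s⟩ := a
    obtain ⟨t⟩ := b
    refine hom_ext fun A => ?_
    change spanMap n (s.sum t) (mk A) = spanMap n s (mk A) + spanMap n t (mk A)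
    rw [spanMap_mk, spanMap_mk, spanMap_mk, ← mk_sum, mk_eq_of_rel (A.applySpan_sum_rel s t)]
  { toFun := Quotient.lift (spanMap n) hrel
    map_zero' := by simpa using hadd 0 0
    map_add' := hadd }

/-- The action of the morphisms of the Burnside category on the groups `SK^G(X)`. -/
noncomputable def burnsideMap (n : ℕ) {X Y : BurnsideCat G} :
    (X ⟶ Y) →+ (SK G n X.toFinGSet →+ SK G n Y.toFinGSet) :=
  GrothendieckAddGroup.lift (spanClassMap n)

lemma burnsideMap_ofSpan (s : GSpan X Y) :
    burnsideMap n (BurnsideCat.ofSpan s) = spanMap n s :=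
  GroupCompletion.lift_of _ _

lemma burnsideMap_comp {X Y Z : BurnsideCat G} (f : X ⟶ Y) (g : Y ⟶ Z) :
    burnsideMap n (f ≫ g) = (burnsideMap n g).comp (burnsideMap n f) := by
  induction f using GroupCompletion.induction with
  | hof a =>
    induction g using GroupCompletion.induction with
    | hof b =>
      obtain ⟨s⟩ := a
      obtain ⟨t⟩ := b
      change burnsideMap n (BurnsideCat.ofSpan s ≫ BurnsideCat.ofSpan t) =
        (burnsideMap n (BurnsideCat.ofSpan t)).comp (burnsideMap n (BurnsideCat.ofSpan s))
      have h : BurnsideCat.ofSpan s ≫ BurnsideCat.ofSpan t = BurnsideCat.ofSpan (s.comp t) :=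
        GroupCompletion.lift₂_of _ _ _
      rw [h, burnsideMap_ofSpan, burnsideMap_ofSpan, burnsideMap_ofSpan, spanMap_comp]
    | hsub x y hx hy =>
      refine (congrArg (burnsideMap n) (Preadditive.comp_sub ..)).trans ?_
      refine (map_sub (burnsideMap n) _ _).trans ?_
      rw [hx, hy]
      refine .trans ?_ (congrArg (AddMonoidHom.comp · _) (map_sub (burnsideMap n) x y).symm)
      rfl
  | hsub x y hx hy =>
    refine (congrArg (burnsideMap n) (Preadditive.sub_comp ..)).trans ?_
    refine (map_sub (burnsideMap n) _ _).trans ?_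
    rw [hx, hy]
    refine .trans ?_ (congrArg (AddMonoidHom.comp _) (map_sub (burnsideMap n) x y).symm)
    ext m
    simp

/-- The Mackey functor `X ↦ SK^G(X)`. -/
noncomputable def mackeyFunctor (G : Type u) [Group G] (n : ℕ) : MackeyFunctor G :=
  let F : BurnsideCat G ⥤ AddCommGrpCat.{u + 1} :=
    { obj := fun X => AddCommGrpCat.of (SK G n X.toFinGSet)
      map := fun f => AddCommGrpCat.ofHom (burnsideMap n f)
      map_id := fun X => congrArg AddCommGrpCat.ofHom
        ((burnsideMap_ofSpan (GSpan.id X.toFinGSet)).trans spanMap_id)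
      map_comp := fun f g => by rw [burnsideMap_comp]; rfl }
  have : F.Additive := ⟨fun {_ _ f g} => congrArg AddCommGrpCat.ofHom (map_add (burnsideMap n) f g)⟩
  AdditiveFunctor.of F

end SK

/-! ### The fibre over the base point of an orbit -/

namespace SingularGManifold

variable {G : Type u} [Group G] [Finite G] {n : ℕ} {H : Subgroup G}

/-- The inclusion of the fibre over `eH`. -/
def fibreVal (A : SingularGManifold G n (FinGSet.orbit H)) (m : A.fibre) : A :=
  (m : A.fibreOpens).1

lemma isChartPreserving_fibreVal (A : SingularGManifold G n (FinGSet.orbit H)) :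
    IsChartPreserving (boundaryModel n) A.fibreVal :=
  IsChartPreserving.opensVal A.fibreOpens

lemma f_fibreVal (A : SingularGManifold G n (FinGSet.orbit H)) (m : A.fibre) :
    A.f (A.fibreVal m) = FinGSet.orbitBase H :=
  m.2

/-- The map of fibres induced by a map over `G/H`. -/
def fibreMap {A B : SingularGManifold G n (FinGSet.orbit H)} (i : A → B)
    (hi : ∀ m, B.f (i m) = A.f m) (m : A.fibre) : B.fibre :=
  (⟨i (A.fibreVal m), (hi _).trans m.2⟩ : B.fibreOpens)

section

variable {A B : SingularGManifold G n (FinGSet.orbit H)} {i : A → B}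
  {hi : ∀ m, B.f (i m) = A.f m}

lemma continuous_fibreMap (h : Continuous i) : Continuous (fibreMap i hi) :=
  (h.comp continuous_subtype_val).subtype_mk _

lemma fibreMap_injective (h : Function.Injective i) : Function.Injective (fibreMap i hi) :=
  fun _ _ hpq => Subtype.ext (h (congrArg B.fibreVal hpq))

lemma fibreMap_smul (h : ∀ (g : G) m, i (g • m) = g • i m) (g : H) (m : A.fibre) :
    fibreMap i hi (g • m) = g • fibreMap i hi m :=
  Subtype.ext (h g (A.fibreVal m))

lemma fibreMap_lift (b : B.fibre) (m : A) (h : B.fibreVal b = i m) :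
    ∃ a, fibreMap i hi a = b ∧ A.fibreVal a = m :=
  ⟨(⟨m, by
    change A.f m = _
    rw [← hi, ← h]
    exact b.2⟩ : A.fibreOpens), Subtype.ext h.symm, rfl⟩

end

lemma _root_.GManifold.IsPasting.fibre {A M₁ M₂ : SingularGManifold G n (FinGSet.orbit H)}
    {S₁ : Set M₁} {S₂ : Set M₂} {i₁ : M₁ → A} {i₂ : M₂ → A}
    (h : A.toGManifold.IsPasting M₁.toGManifold M₂.toGManifold S₁ S₂ i₁ i₂)
    (h₁ : ∀ m, A.f (i₁ m) = M₁.f m) (h₂ : ∀ m, A.f (i₂ m) = M₂.f m) :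
    A.fibre.toGManifold.IsPasting M₁.fibre.toGManifold M₂.fibre.toGManifold
      (M₁.fibreVal ⁻¹' S₁) (M₂.fibreVal ⁻¹' S₂) (fibreMap i₁ h₁) (fibreMap i₂ h₂) :=
  h.lift A.isChartPreserving_fibreVal M₁.isChartPreserving_fibreVal M₂.isChartPreserving_fibreVal
    (continuous_fibreMap h.isGEmbedding₁.isEmbedding.continuous)
    (continuous_fibreMap h.isGEmbedding₂.isEmbedding.continuous)
    (fibreMap_injective h.isGEmbedding₁.isEmbedding.injective)
    (fibreMap_injective h.isGEmbedding₂.isEmbedding.injective)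
    (fibreMap_smul h.isGEmbedding₁.map_smul) (fibreMap_smul h.isGEmbedding₂.map_smul)
    (fun _ => rfl) (fun _ => rfl) fibreMap_lift fibreMap_lift

lemma SKOperation.fibre {A B : SingularGManifold G n (FinGSet.orbit H)} (h : A.SKOperation B) :
    A.fibre.SKOperation B.fibre := by
  obtain ⟨M₁, M₂, S₁, S₂, i₁, i₂, j₁, j₂, hi, hj, h₁, h₂⟩ := h
  have h₁ := h₁.eq
  have h₂ := h₂.eq
  exact ⟨(A.restrict hi.isGEmbedding₁).fibre.toGManifold,
    (A.restrict hi.isGEmbedding₂).fibre.toGManifold, _, _,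
    _, _, _, _, hi.fibre (M₁ := A.restrict hi.isGEmbedding₁)
      (M₂ := A.restrict hi.isGEmbedding₂) (fun _ => rfl) (fun _ => rfl),
    hj.fibre (M₁ := A.restrict hi.isGEmbedding₁)
      (M₂ := A.restrict hi.isGEmbedding₂) (fun m => (congrFun h₁ m).symm)
      (fun m => (congrFun h₂ m).symm),
    .refl continuous_const fun _ _ => rfl, .refl continuous_const fun _ _ => rfl⟩

lemma Rel.fibre {A B : SingularGManifold G n (FinGSet.orbit H)} (h : A.Rel B) :
    A.fibre.Rel B.fibre := by
  obtain ⟨φ, hφ⟩ := h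
  have hφ' (m) : A.f (φ.toDiffeo.symm m) = B.f m := by rw [← hφ, φ.toDiffeo.apply_symm_apply]
  exact .of_isChartPreserving A.isChartPreserving_fibreVal B.isChartPreserving_fibreVal
    ⟨fibreMap φ.toDiffeo hφ, fibreMap φ.toDiffeo.symm hφ',
      fun p => Subtype.ext (φ.toDiffeo.symm_apply_apply _),
      fun p => Subtype.ext (φ.toDiffeo.apply_symm_apply _)⟩
    (continuous_fibreMap (hi := hφ) φ.toDiffeo.continuous)
    (φ.toDiffeo.contMDiff.comp A.isChartPreserving_fibreVal.contMDiff)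
    (φ.toDiffeo.symm.contMDiff.comp B.isChartPreserving_fibreVal.contMDiff)
    (fibreMap_smul (hi := hφ) φ.map_smul) (fun _ => rfl)

lemma sum_fibre_rel (A B : SingularGManifold G n (FinGSet.orbit H)) :
    (A.fibre.sum B.fibre).Rel (A.sum B).fibre := by
  refine .of_comp_eq ((IsChartPreserving.inl.comp A.isChartPreserving_fibreVal).sumElim
    (IsChartPreserving.inr.comp B.isChartPreserving_fibreVal))
    (A.sum B).isChartPreserving_fibreVal
    ⟨Sum.elim (fibreMap (A := A) (B := A.sum B) Sum.inl fun _ => rfl)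
      (fibreMap (A := B) (B := A.sum B) Sum.inr fun _ => rfl),
      fun p => match p with
        | ⟨Sum.inl m, h⟩ => Sum.inl (⟨m, h⟩ : A.fibreOpens)
        | ⟨Sum.inr m, h⟩ => Sum.inr (⟨m, h⟩ : B.fibreOpens), ?_, ?_⟩
    ((continuous_fibreMap continuous_inl).sumElim (continuous_fibreMap continuous_inr)) ?_ ?_ ?_
  · rintro (_ | _) <;> rfl
  · rintro ⟨m | m, h⟩ <;> rfl
  · rintro (_ | _) <;> rfl
  · rintro g (_ | _) <;> rfl
  · rintro (_ | _) <;> rfl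

end SingularGManifold

/-! ### Induction from a subgroup -/

namespace FinGSet

variable {G : Type u} [Group G] [Finite G] {H : Subgroup G}

open Classical in
/-- A section of `G → G/H` that sends `eH` to `1`. -/
noncomputable def orbitSection (x : orbit H) : G :=
  if x = orbitBase H then 1 else Quotient.out (s := QuotientGroup.leftRel H) x

lemma orbitSection_smul (x : orbit H) : orbitSection x • orbitBase H = x := by
  rw [orbitSection]
  split_ifs with h
  · rw [one_smul, h]
  · change ((_ * 1 : G) : G ⧸ H) = x
    rw [mul_one]
    exact QuotientGroup.out_eq' x

lemma orbitSection_base : orbitSection (orbitBase H) = 1 := if_pos rfl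

lemma smul_orbitBase_eq_iff {g : G} : g • orbitBase H = orbitBase H ↔ g ∈ H := by
  change ((g * 1 : G) : G ⧸ H) = ((1 : G) : G ⧸ H) ↔ _
  rw [mul_one, QuotientGroup.eq]
  simp

/-- The element `h` of `H` with `g σ(x) = σ(g x) h`, where `σ` is the section `orbitSection`. -/
noncomputable def orbitCocycle (g : G) (x : orbit H) : H :=
  ⟨(orbitSection (g • x))⁻¹ * g * orbitSection x, by
    rw [← smul_orbitBase_eq_iff, mul_smul, orbitSection_smul, mul_smul, inv_smul_eq_iff,
      orbitSection_smul]⟩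

lemma orbitCocycle_one (x : orbit H) : orbitCocycle 1 x = 1 :=
  Subtype.ext (by simp [orbitCocycle])

lemma orbitCocycle_mul (g h : G) (x : orbit H) :
    orbitCocycle (g * h) x = orbitCocycle g (h • x) * orbitCocycle h x :=
  Subtype.ext (by simp [orbitCocycle, mul_smul, mul_assoc])

lemma orbitCocycle_base (h : H) : orbitCocycle (h : G) (orbitBase H) = h :=
  Subtype.ext (by simp [orbitCocycle, smul_orbitBase_eq_iff.2 h.2, orbitSection_base])

end FinGSet

lemma ContMDiff.of_locallyConstant {E E' E'' K K' K'' M N P D : Type*}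
    [NormedAddCommGroup E] [NormedSpace ℝ E] [TopologicalSpace K] {I : ModelWithCorners ℝ E K}
    [TopologicalSpace M] [ChartedSpace K M]
    [NormedAddCommGroup E'] [NormedSpace ℝ E'] [TopologicalSpace K'] {I' : ModelWithCorners ℝ E' K'}
    [TopologicalSpace N] [ChartedSpace K' N]
    [NormedAddCommGroup E''] [NormedSpace ℝ E''] [TopologicalSpace K'']
    {I'' : ModelWithCorners ℝ E'' K''} [TopologicalSpace P] [ChartedSpace K'' P]
    [TopologicalSpace D] [DiscreteTopology D] {k : WithTop ℕ∞} {F : D → N → P}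
    (hF : ∀ d, ContMDiff I' I'' k (F d)) {c : M → D} (hc : Continuous c) {f : M → N}
    (hf : ContMDiff I I' k f) : ContMDiff I I'' k fun m => F (c m) (f m) := by
  intro m
  refine ((hF (c m)).comp hf m).congr_of_eventuallyEq ?_
  filter_upwards [hc.continuousAt (isOpen_discrete {c m} |>.mem_nhds rfl)] with m' hm'
  rw [show c m' = c m from hm']
  rfl

namespace GManifold

open FinGSet

variable {G : Type u} [Group G] [Finite G] {n : ℕ} {H : Subgroup G}

/-- The space `G ×_H N` of the induced `G`-manifold of an `H`-manifold `N`, trivialized as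
`G/H × N` by means of the section `orbitSection`. -/
def InducedSpace (N : GManifold H n) : Type u := orbit H × N

namespace InducedSpace

variable (N : GManifold H n)

instance : TopologicalSpace (InducedSpace N) := inferInstanceAs (TopologicalSpace (orbit H × N))
instance : T2Space (InducedSpace N) := inferInstanceAs (T2Space (orbit H × N))
instance : CompactSpace (InducedSpace N) := inferInstanceAs (CompactSpace (orbit H × N))

/-- In terms of the trivialization `[σ(x), m] ↔ (x, m)` of `G ×_H N`, the element `g` sends
`[σ(x), m]` to `[g σ(x), m] = [σ(g x) h, m] = [σ(g x), h m]`. -/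
noncomputable instance : MulAction G (InducedSpace N) where
  smul g p := (g • p.1, orbitCocycle g p.1 • p.2)
  one_smul p := Prod.ext (one_smul G p.1)
    ((congrArg (· • p.2) (orbitCocycle_one p.1)).trans (one_smul H p.2))
  mul_smul g h p := Prod.ext (mul_smul g h p.1)
    ((congrArg (· • p.2) (orbitCocycle_mul g h p.1)).trans (mul_smul _ _ p.2))

/-- The projection of `G ×_H N = G/H × N` to `N`, which is not equivariant. -/
def snd (p : InducedSpace N) : N := p.2

lemma isLocalHomeomorph_snd : IsLocalHomeomorph (snd N) := by
  rw [isLocalHomeomorph_iff_isOpenEmbedding_restrict]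
  intro p
  have hs : IsOpen {q : InducedSpace N | q.1 = p.1} :=
    (isOpen_discrete {p.1}).preimage continuous_fst
  refine ⟨_, hs.mem_nhds rfl, .of_continuous_injective_isOpenMap
    (continuous_snd.comp continuous_subtype_val) ?_ (isOpenMap_snd.domRestrict hs)⟩
  rintro ⟨⟨x, m⟩, hx⟩ ⟨⟨y, m'⟩, hy⟩ h
  exact Subtype.ext (Prod.ext (hx.trans hy.symm) h)

noncomputable instance : ChartedSpace (BoundaryModelSpace n) (InducedSpace N) :=
  LocalHomeoPullback.chartedSpace (isLocalHomeomorph_snd N)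

lemma isChartPreserving_snd : IsChartPreserving (boundaryModel n) (snd N) :=
  IsChartPreserving.of_isLocalHomeomorph (isLocalHomeomorph_snd N) _

instance : IsManifold (boundaryModel n) ∞ (InducedSpace N) :=
  LocalHomeoPullback.isManifold (isLocalHomeomorph_snd N) _ _

lemma contMDiff_smul (g : G) :
    ContMDiff (boundaryModel n) (boundaryModel n) ∞ fun p : InducedSpace N => g • p := by
  have hc : Continuous fun p : InducedSpace N => p.1 := continuous_fst
  have h : ContMDiff (boundaryModel n) (boundaryModel n) ∞
      fun p : InducedSpace N => orbitCocycle g p.1 • snd N p :=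
    .of_locallyConstant (F := fun (x : orbit H) (m : N) => orbitCocycle g x • m)
      (fun x => N.contMDiff_smul (orbitCocycle g x)) hc (isChartPreserving_snd N).contMDiff
  exact (isChartPreserving_snd N).contMDiff_of_comp
    (((continuous_of_discreteTopology (f := fun x : orbit H => g • x)).comp
      hc).prodMk h.continuous) h

end InducedSpace

/-- The induced `G`-manifold `G ×_H N`. -/
noncomputable def inducedManifold (N : GManifold H n) : GManifold G n where
  carrier := InducedSpace N
  contMDiff_smul := InducedSpace.contMDiff_smul N

/-- The induced `G`-manifold `G ×_H N` with its projection to `G/H`. -/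
noncomputable def induce (N : GManifold H n) : SingularGManifold G n (orbit H) where
  toGManifold := N.inducedManifold
  f := Prod.fst (α := orbit H) (β := N)
  continuous_f := continuous_fst
  f_smul _ _ := rfl

/-- The projection of `G ×_H N = G/H × N` to `N`, which is not equivariant. -/
def induceSnd (N : GManifold H n) : N.induce → N := InducedSpace.snd N

lemma isChartPreserving_induceSnd (N : GManifold H n) :
    IsChartPreserving (boundaryModel n) N.induceSnd :=
  InducedSpace.isChartPreserving_snd N

/-- The map `G ×_H N → G ×_H N'` induced by a map `N → N'`. -/
def induceMap {N N' : GManifold H n} (i : N → N') (p : N.induce) : N'.induce :=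
  ((p.1, i p.2) : InducedSpace N')

section

variable {N N' : GManifold H n} {i : N → N'}

lemma continuous_induceMap (h : Continuous i) : Continuous (induceMap i) :=
  continuous_fst.prodMk (h.comp continuous_snd)

lemma induceMap_injective (h : Function.Injective i) : Function.Injective (induceMap i) :=
  Function.injective_id.prodMap h

lemma induceMap_smul (h : ∀ (g : H) m, i (g • m) = g • i m) (g : G) (p : N.induce) :
    induceMap i (g • p) = g • induceMap i p :=
  Prod.ext rfl (h (orbitCocycle g p.1) p.2)

lemma induceMap_lift (b : N'.induce) (m : N) (h : N'.induceSnd b = i m) :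
    ∃ a, induceMap i a = b ∧ N.induceSnd a = m :=
  ⟨((b.1, m) : InducedSpace N), Prod.ext rfl h.symm, rfl⟩

end

lemma IsPasting.induce {A M₁ M₂ : GManifold H n} {S₁ : Set M₁} {S₂ : Set M₂} {i₁ : M₁ → A}
    {i₂ : M₂ → A} (h : A.IsPasting M₁ M₂ S₁ S₂ i₁ i₂) :
    A.induce.toGManifold.IsPasting M₁.induce.toGManifold M₂.induce.toGManifold
      (M₁.induceSnd ⁻¹' S₁) (M₂.induceSnd ⁻¹' S₂) (induceMap i₁) (induceMap i₂) :=
  h.lift A.isChartPreserving_induceSnd M₁.isChartPreserving_induceSnd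
    M₂.isChartPreserving_induceSnd
    (continuous_induceMap h.isGEmbedding₁.isEmbedding.continuous)
    (continuous_induceMap h.isGEmbedding₂.isEmbedding.continuous)
    (induceMap_injective h.isGEmbedding₁.isEmbedding.injective)
    (induceMap_injective h.isGEmbedding₂.isEmbedding.injective)
    (induceMap_smul h.isGEmbedding₁.map_smul) (induceMap_smul h.isGEmbedding₂.map_smul)
    (fun _ => rfl) (fun _ => rfl) induceMap_lift induceMap_lift

lemma GDiffeo.induce_rel {N N' : GManifold H n} (φ : GDiffeo N N') : N.induce.Rel N'.induce :=
  .of_isChartPreserving N.isChartPreserving_induceSnd N'.isChartPreserving_induceSnd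
    ⟨induceMap φ.toDiffeo, induceMap φ.toDiffeo.symm,
      fun _ => Prod.ext rfl (φ.toDiffeo.symm_apply_apply _),
      fun _ => Prod.ext rfl (φ.toDiffeo.apply_symm_apply _)⟩
    (continuous_induceMap φ.toDiffeo.continuous)
    (φ.toDiffeo.contMDiff.comp N.isChartPreserving_induceSnd.contMDiff)
    (φ.toDiffeo.symm.contMDiff.comp N'.isChartPreserving_induceSnd.contMDiff)
    (induceMap_smul φ.map_smul) (fun _ => rfl)

end GManifold

namespace SingularGManifold

open FinGSet GManifold

variable {G : Type u} [Group G] [Finite G] {n : ℕ} {H : Subgroup G}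

lemma SKOperation.induce {A B : SingularGManifold H n PUnit.{u + 1}} (h : A.SKOperation B) :
    A.toGManifold.induce.SKOperation B.toGManifold.induce := by
  obtain ⟨M₁, M₂, S₁, S₂, i₁, i₂, j₁, j₂, hi, hj, -, -⟩ := h
  exact ⟨M₁.induce.toGManifold, M₂.induce.toGManifold, _, _, _, _, _, _, hi.induce, hj.induce,
    .refl M₁.induce.continuous_f M₁.induce.f_smul, .refl M₂.induce.continuous_f M₂.induce.f_smul⟩

lemma sum_induce_rel (A B : SingularGManifold H n PUnit.{u + 1}) :
    (A.toGManifold.induce.sum B.toGManifold.induce).Rel (A.sum B).toGManifold.induce := by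
  refine .of_comp_eq ((IsChartPreserving.inl.comp A.isChartPreserving_induceSnd).sumElim
    (IsChartPreserving.inr.comp B.isChartPreserving_induceSnd))
    (A.sum B).isChartPreserving_induceSnd
    ⟨Sum.elim (induceMap (N := A.toGManifold) (N' := (A.sum B).toGManifold) Sum.inl)
      (induceMap (N := B.toGManifold) (N' := (A.sum B).toGManifold) Sum.inr),
      fun p => match p with
        | (x, Sum.inl m) => Sum.inl ((x, m) : InducedSpace A.toGManifold)
        | (x, Sum.inr m) => Sum.inr ((x, m) : InducedSpace B.toGManifold), ?_, ?_⟩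
    ((continuous_induceMap continuous_inl).sumElim (continuous_induceMap continuous_inr)) ?_ ?_ ?_
  · rintro (_ | _) <;> rfl
  · rintro ⟨x, m | m⟩ <;> rfl
  · rintro (_ | _) <;> rfl
  · rintro g (_ | _) <;> rfl
  · rintro (_ | _) <;> rfl

/-- The fibre of `G ×_H N` over `eH` is `N`. -/
lemma fibre_induce_rel (A : SingularGManifold H n PUnit.{u + 1}) :
    A.toGManifold.induce.fibre.Rel A := by
  have hb (p : A.toGManifold.induce.fibre) : p.1.1 = orbitBase H := p.2
  refine .of_comp_eq (A.isChartPreserving_induceSnd.comp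
    A.toGManifold.induce.isChartPreserving_fibreVal) IsChartPreserving.id
    ⟨fun p => p.1.2, fun m => (⟨((orbitBase H, m) : InducedSpace A.toGManifold), rfl⟩ :
      A.toGManifold.induce.fibreOpens), fun p => Subtype.ext (Prod.ext (hb p).symm rfl),
      fun _ => rfl⟩
    (continuous_snd.comp continuous_subtype_val) (fun _ => rfl) (fun h p => ?_) (fun _ => rfl)
  change orbitCocycle (h : G) p.1.1 • p.1.2 = h • p.1.2
  rw [hb, orbitCocycle_base]

/-- The map `[g, m] ↦ g m` is a diffeomorphism `G ×_H f⁻¹(eH) → M` for every singular manifold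
`(M, f)` in `G/H`. -/
lemma induce_fibre_rel (A : SingularGManifold G n (orbit H)) :
    A.fibre.toGManifold.induce.Rel A := by
  have hf (x : orbit H) (m : A.fibre) : A.f (orbitSection x • A.fibreVal m) = x := by
    rw [A.f_smul, A.f_fibreVal, orbitSection_smul]
  have hs : ContMDiff (boundaryModel n) (boundaryModel n) ∞
      fun p : A.fibre.toGManifold.induce =>
        orbitSection p.1 • A.fibreVal (A.fibre.induceSnd p) :=
    .of_locallyConstant (F := fun (x : orbit H) (m : A) => orbitSection x • m)
      (c := A.fibre.toGManifold.induce.f)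
      (fun x => A.contMDiff_smul (orbitSection x)) A.fibre.toGManifold.induce.continuous_f
      (A.isChartPreserving_fibreVal.comp A.fibre.isChartPreserving_induceSnd).contMDiff
  have hs' : ContMDiff (boundaryModel n) (boundaryModel n) ∞
      fun m : A => (orbitSection (A.f m))⁻¹ • m :=
    .of_locallyConstant (F := fun (x : orbit H) (m : A) => (orbitSection x)⁻¹ • m)
      (fun x => A.contMDiff_smul (orbitSection x)⁻¹) A.continuous_f contMDiff_id
  refine .of_isChartPreserving
    (A.isChartPreserving_fibreVal.comp A.fibre.isChartPreserving_induceSnd) IsChartPreserving.id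
    ⟨fun p => orbitSection p.1 • A.fibreVal (A.fibre.induceSnd p),
      fun m => ((A.f m, (⟨(orbitSection (A.f m))⁻¹ • m, ?_⟩ : A.fibreOpens)) :
        InducedSpace A.fibre.toGManifold), fun p => ?_, fun m => ?_⟩
    hs.continuous hs hs' (fun g p => ?_) (fun p => hf _ _)
  · change A.f _ = _
    rw [A.f_smul, inv_smul_eq_iff, orbitSection_smul]
  · refine Prod.ext (hf _ _) (Subtype.ext ?_)
    change (orbitSection (A.f (orbitSection p.1 • _)))⁻¹ • orbitSection p.1 • _ = _
    rw [hf, inv_smul_smul]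
    rfl
  · exact smul_inv_smul (orbitSection (A.f m)) m
  · change orbitSection (g • p.1) • ((orbitSection (g • p.1))⁻¹ * g * orbitSection p.1) •
      A.fibreVal (A.fibre.induceSnd p) = g • orbitSection p.1 • A.fibreVal (A.fibre.induceSnd p)
    simp only [← mul_smul, mul_assoc, mul_inv_cancel_left]

end SingularGManifold

namespace SK

open SingularGManifold

variable {G : Type u} [Group G] [Finite G]

/-- The isomorphism `SK^G(G/H) ≅ SK^H` that sends `[M, f]` to `[f⁻¹(eH)]`; its inverse sends `[N]`
to `[G ×_H N]`. -/
noncomputable def orbitEquiv (n : ℕ) (H : Subgroup G) :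
    SK G n (FinGSet.orbit H) ≃+ SKPoint H n :=
  AddMonoidHom.toAddEquiv
    (lift (fun A => mk A.fibre) (fun _ _ h => mk_eq_of_rel h.fibre)
      (fun A B => by rw [← mk_eq_of_rel (sum_fibre_rel A B), mk_sum])
      (fun _ _ h => mk_eq_of_skOperation h.fibre))
    (lift (fun A => mk A.toGManifold.induce) (fun _ _ ⟨φ, _⟩ => mk_eq_of_rel φ.induce_rel)
      (fun A B => by rw [← mk_eq_of_rel (sum_induce_rel A B), mk_sum])
      (fun _ _ h => mk_eq_of_skOperation h.induce))
    (hom_ext fun A => by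
      rw [AddMonoidHom.comp_apply, lift_mk, lift_mk, mk_eq_of_rel A.induce_fibre_rel]
      rfl)
    (hom_ext fun A => by
      rw [AddMonoidHom.comp_apply, lift_mk, lift_mk, mk_eq_of_rel A.fibre_induce_rel]
      rfl)

lemma orbitEquiv_mk (n : ℕ) (H : Subgroup G) (A : SingularGManifold G n (FinGSet.orbit H)) :
    orbitEquiv n H (mk A) = mk A.fibre :=
  lift_mk _ (fun _ _ h => mk_eq_of_rel h.fibre) _ (fun _ _ h => mk_eq_of_skOperation h.fibre) A

end SK

theorem mainTheorem1 {G : Type u} [Group G] [Finite G] (n : ℕ) :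
    ∃ φ : ∀ X Y : FinGSet G, GSpan X Y → (SK G n X →+ SK G n Y),
      (∀ (X Y : FinGSet G) (s : GSpan X Y) (A : SingularGManifold G n X),
        φ X Y s (SK.mk A) = SK.mk (A.applySpan s)) ∧
      (∃ (F : MackeyFunctor G)
        (hF : ∀ X : FinGSet G, F.obj.obj (BurnsideCat.of X) = AddCommGrpCat.of (SK G n X)),
        ∀ (X Y : FinGSet G) (s : GSpan X Y),
          F.obj.map (BurnsideCat.ofSpan s) =
            eqToHom (hF X) ≫ AddCommGrpCat.ofHom (φ X Y s) ≫ eqToHom (hF Y).symm) ∧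
      ∀ H : Subgroup G, ∃ e : SK G n (FinGSet.orbit H) ≃+ SKPoint H n,
        ∀ A : SingularGManifold G n (FinGSet.orbit H), e (SK.mk A) = SK.mk A.fibre := by
  refine ⟨fun _ _ s => SK.spanMap n s, fun _ _ => SK.spanMap_mk,
    ⟨SK.mackeyFunctor G n, fun _ => rfl, fun X Y s => ?_⟩,
    fun H => ⟨SK.orbitEquiv n H, SK.orbitEquiv_mk n H⟩⟩
  exact congrArg AddCommGrpCat.ofHom (SK.burnsideMap_ofSpan s)
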